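/- Let $0<\alpha<1$. For $\gamma>0$ let $f_\gamma(x)=x^{\alpha\gamma-1}\gamma^\gamma E^\gamma_{(\alpha,\alpha\gamma)}(-\gamma x^\alpha)$ for $x>0$ and $f_\gamma(x)=0$ for $x\le 0$, where $$E^\gamma_{(a,b)}(z)=\sum_{k=0}^\infty \frac{(\gamma)_k\,z^k}{k!\,\Gamma(ak+b)},\qquad (\gamma)_k=\gamma(\gamma+1)\cdots(\gamma+k-1),\ (\gamma)_0=1.$$ All complex powers are principal values. (a) For every $\gamma>0$ the series defining $E^\gamma_{(\alpha,\alpha\gamma)}(z)$ converges for all real $z$, $f_\gamma$ is a probability density on $(0,\infty)$, and its Laplace transform is $$\int_0^\infty e^{-sx}f_\gamma(x)\,dx=\Bigl(1+\frac{s^\alpha}{\gamma}\Bigr)^{-\gamma}\qquad(\operatorname{Re}s\ge 0).$$ Moreover, for every real $c$ with $\max(0,1-\alpha\gamma)<c<1$ and every $x>0$, $$f_\gamma(x)=\frac1{2\pi i}\int_{c-i\infty}^{c+i\infty}\frac{\Gamma\bigl(\gamma+\frac s\alpha-\frac1\alpha\bigr)\Gamma\bigl(\frac1\alpha-\frac s\alpha\bigr)}{\alpha\,\Gamma(\gamma)\,\Gamma(1-s)}\,\gamma^{\frac1\alpha-\frac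 s\alpha}\,x^{-s}\,ds,$$ the integral being absolutely convergent. (b) There is exactly one probability density $\ell_\alpha$ on $\mathbb R$ that vanishes on $(-\infty,0]$, is continuous on $(0,\infty)$ and satisfies $$\int_0^\infty e^{-sx}\ell_\alpha(x)\,dx=e^{-s^\alpha}\qquad(\operatorname{Re}s\ge 0);$$ it is the Lévy (one-sided $\alpha$-stable) density. As $\gamma\to\infty$ through the reals, $f_\gamma(x)\to\ell_\alpha(x)$ for every $x$, and the Laplace transform of $f_\gamma$ converges to that of $\ell_\alpha$ at every $s$ with $\operatorname{Re}s\ge0$. For every $0<c<1$ and every $x>0$, $$\ell_\alpha(x)=\frac1{2\pi i}\int_{c-i\infty}^{c+i\infty}\frac{\Gamma\bigl(\frac1\alpha-\frac s\alpha\bigr)}{\alpha\,\Gamma(1-s)}\,x^{-s}\,ds,$$ the integral being absolutely convergent. -/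

import Mathlib

open Set Filter Topology MeasureTheory

noncomputable section

/-- The three-parameter (Prabhakar) Mittag-Leffler function
`E^γ_{(a,b)}(z) = ∑_{k ≥ 0} (γ)_k z^k / (k! Γ(a k + b))`. -/
def mittagLeffler (a b γ z : ℝ) : ℝ :=
  ∑' k : ℕ, (ascPochhammer ℝ k).eval γ * z ^ k / (k.factorial * Real.Gamma (a * k + b))

/-- The generalized Mittag-Leffler density
`x^{αγ-1} γ^γ E^γ_{(α,αγ)}(-γ x^α)` on `x > 0`, extended by zero. -/
def mlDensity (α γ x : ℝ) : ℝ :=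
  if 0 < x then
    x ^ (α * γ - 1) * γ ^ γ * mittagLeffler α (α * γ) γ (-γ * x ^ α)
  else 0

/-- `f` is a probability density on the real line supported in the positive half-line. -/
structure IsPositiveDensity (f : ℝ → ℝ) : Prop where
  eq_zero : ∀ x ≤ 0, f x = 0
  nonneg : ∀ x, 0 ≤ f x
  integrable : Integrable f
  integral_eq_one : ∫ x, f x = 1

/-- The Laplace transform `∫_0^∞ e^{-s x} f(x) dx`. -/
def laplaceTransform (f : ℝ → ℝ) (s : ℂ) : ℂ :=
  ∫ x in Ioi (0 : ℝ), Complex.exp (-s * x) * (f x : ℂ)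

/-- `f` is the Lévy (one-sided `α`-stable) density: the probability density on `(0, ∞)`,
in its continuous version, whose Laplace transform is `e^{-s^α}`. -/
structure IsLevyDensity (α : ℝ) (f : ℝ → ℝ) : Prop where
  density : IsPositiveDensity f
  continuousOn : ContinuousOn f (Ioi 0)
  laplace : ∀ s : ℂ, 0 ≤ s.re → laplaceTransform f s = Complex.exp (-s ^ (α : ℂ))

/-- The Mellin-Barnes kernel of the generalized Mittag-Leffler density. -/
def mlKernel (α γ : ℝ) (s : ℂ) : ℂ :=
  Complex.Gamma (γ + s / α - 1 / α) * Complex.Gamma (1 / α - s / α) /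
    (α * Complex.Gamma γ * Complex.Gamma (1 - s)) * (γ : ℂ) ^ (1 / α - s / α)

/-- The Mellin-Barnes kernel `Γ(1/α - s/α) / (α Γ(1 - s))`. -/
def levyKernel (α : ℝ) (s : ℂ) : ℂ :=
  Complex.Gamma (1 / α - s / α) / (α * Complex.Gamma (1 - s))

/-- `f(x) = (1/2πi) ∫_{Re s = c} F(s) x^{-s} ds` for all `x > 0`, the integral being
absolutely convergent. (`mellinInv c F x` is this contour integral, parametrized by
`s = c + iy`.) -/
def HasMellinBarnes (f : ℝ → ℝ) (F : ℂ → ℂ) (c : ℝ) : Prop :=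
  Complex.VerticalIntegrable F c ∧ ∀ x : ℝ, 0 < x → (f x : ℂ) = mellinInv c F x

end

/-! Write e_{γ,b}(t) = t^(b-1) E^γ_{(α,b)}(-c t^α), with formal Laplace transform s^(-b) (1 + c
s^(-α))^(-γ). These kernels convolve by adding γ and b (`integral_prabhakar_conv`), and f_γ is γ^γ
e_{γ,αγ} with c = γ.

Positivity. Multiplication by t is -d/ds on the Laplace side, so t e_{γ,αγ} = αγ (e_{1,1} *
e_{γ,αγ}) (`mul_prabhakar_eq_conv`). A function that is positive near 0 and obeys this equation
cannot have a first zero, once e_{1,1} > 0. Since also e_{1,1} < 1, a maximum argument gives f_γ(x)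
≤ C x^(αγ-1), so the Laplace integral converges for Re s > 0.

Laplace transform. Termwise integration works only for large real s; the identity theorem extends
the formula to Re s > 0, and Fatou with a limit to the boundary gives integrability, mass 1 and the
case Re s = 0 (`isPositiveDensity_and_laplace`).

Mellin-Barnes. Integrating a Laplace transform against t^(w-1) yields Γ(w) times the Mellin
transform of the density at 1 - w (`mellin_of_laplace`), and Mellin inversion then recovers the
density. The kernel is integrable because Γ((1-s)/α) decays like exp(-π|Im s|/(2α)), up to powers,
while 1/Γ(1-s) grows at most like exp(π|Im s|/2), and α < 1.

Limit. The kernel of f_γ is the Lévy kernel times a Gamma ratio tending to 1 and bounded on vertical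
lines. Dominated convergence gives f_γ → ℓ pointwise, where ℓ is defined by its Mellin-Barnes
integral, and f_γ(x) ≤ C x^(-1/2) uniformly for large γ. Hence Laplace transforms converge for Re s
> 0, and the same boundary lemma makes ℓ a density with transform exp(-s^α). Uniqueness is Mellin
inversion again. -/

/-! ### Binomial coefficients of (1 - x)^(-γ) -/

/-- The coefficient `(γ)_k / k!` of the binomial series of `(1 - x)^(-γ)`. -/
noncomputable def pochCoeff (γ : ℝ) (k : ℕ) : ℝ := (ascPochhammer ℝ k).eval γ / k.factorial

theorem pochCoeff_nonneg {γ : ℝ} (hγ : 0 ≤ γ) (k : ℕ) : 0 ≤ pochCoeff γ k := by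
  rcases hγ.eq_or_lt with rfl | h
  · rcases k with _ | k <;> simp [pochCoeff]
  · exact div_nonneg (ascPochhammer_pos k γ h).le (by positivity)

theorem pochCoeff_zero_right (γ : ℝ) : pochCoeff γ 0 = 1 := by simp [pochCoeff]

theorem pochCoeff_zero_succ (k : ℕ) : pochCoeff 0 (k + 1) = 0 := by simp [pochCoeff]

theorem pochCoeff_eq_multichoose (γ : ℝ) (k : ℕ) : pochCoeff γ k = Ring.multichoose γ k := by
  have h := Ring.factorial_nsmul_multichoose_eq_ascPochhammer γ k
  rw [nsmul_eq_mul, Polynomial.ascPochhammer_smeval_eq_eval] at h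
  rw [pochCoeff, ← h]
  field_simp

theorem pochCoeff_eq_choose (γ : ℝ) (k : ℕ) : pochCoeff γ k = Ring.choose (γ + k - 1) k := by
  rw [pochCoeff_eq_multichoose, Ring.multichoose_eq]

theorem pochCoeff_eq_neg_choose (γ : ℝ) (k : ℕ) :
    pochCoeff γ k = (-1) ^ k * Ring.choose (-γ) k := by
  rw [pochCoeff_eq_choose, Ring.choose_neg]
  simp [Units.smul_def, ← mul_assoc, ← mul_pow]

/-- Chu-Vandermonde with upper arguments -γ and -δ; this is the algebra behind the convolution of
Prabhakar kernels. -/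
theorem pochCoeff_add (γ δ : ℝ) (k : ℕ) :
    pochCoeff (γ + δ) k = ∑ p ∈ Finset.HasAntidiagonal.antidiagonal k, pochCoeff γ p.1 * pochCoeff δ p.2 := by
  simp only [pochCoeff_eq_neg_choose]
  rw [neg_add, Ring.add_choose_eq k (Commute.all _ _), Finset.mul_sum]
  refine Finset.sum_congr rfl fun p hp => ?_
  rw [← Finset.HasAntidiagonal.mem_antidiagonal.1 hp, pow_add]
  ring

theorem pochCoeff_one (k : ℕ) : pochCoeff 1 k = 1 := by
  rw [pochCoeff_eq_multichoose, Ring.multichoose_one]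

/-- Both sides are (γ)_{k+1} / k!. -/
theorem add_mul_pochCoeff (γ : ℝ) (k : ℕ) :
    (k + γ) * pochCoeff γ k = γ * pochCoeff (γ + 1) k := by
  have h := ascPochhammer_succ_eval (S := ℝ) k γ
  have h' : (ascPochhammer ℝ (k + 1)).eval γ = γ * (ascPochhammer ℝ k).eval (γ + 1) := by
    rw [ascPochhammer_succ_left]
    simp [Polynomial.eval_comp]
  rw [pochCoeff, pochCoeff, ← mul_div_assoc, ← mul_div_assoc, ← h', h]
  ring

theorem hasSum_pochCoeff_mul_pow (γ : ℝ) {z : ℂ} (hz : ‖z‖ < 1) :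
    HasSum (fun k => (pochCoeff γ k : ℂ) * z ^ k) (1 / (1 - z) ^ (γ : ℂ)) := by
  have h := (Complex.one_div_one_sub_cpow_hasFPowerSeriesOnBall_zero (γ : ℂ)).hasSum
    (y := z) (by simpa [← ENNReal.ofReal_one, Metric.eball_ofReal] using hz)
  rw [zero_add] at h
  refine h.congr_fun fun k => ?_
  rw [FormalMultilinearSeries.ofScalars_apply_eq, smul_eq_mul, pochCoeff_eq_choose,
    Complex.ofReal_choose]
  push_cast
  rfl

theorem summable_pochCoeff_mul_pow (γ : ℝ) {x : ℝ} (hx : |x| < 1) :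
    Summable (fun k => pochCoeff γ k * x ^ k) := by
  have h := (hasSum_pochCoeff_mul_pow γ (z := (x : ℂ)) (by simpa using hx)).summable
  exact_mod_cast h

/-! ### Convergence and continuity of the Mittag-Leffler series -/

/-- Only the part t > M of Euler's integral is kept. As M is arbitrary, Γ outgrows every geometric
sequence. -/
theorem exp_neg_mul_rpow_le_Gamma {M x : ℝ} (hM : 0 < M) (hx : 1 ≤ x) :
    Real.exp (-M) * M ^ (x - 1) ≤ Real.Gamma x := by
  rw [Real.Gamma_eq_integral (by linarith)]
  have h1 : ∫ t in Ioi M, Real.exp (-t) * M ^ (x - 1) = Real.exp (-M) * M ^ (x - 1) := by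
    rw [integral_mul_const, integral_exp_neg_Ioi]
  rw [← h1]
  have hI := Real.GammaIntegral_convergent (s := x) (by linarith)
  have hsub : Ioi M ⊆ Ioi (0 : ℝ) := Ioi_subset_Ioi hM.le
  calc _ ≤ ∫ t in Ioi M, Real.exp (-t) * t ^ (x - 1) := by
        refine setIntegral_mono_on ((integrableOn_exp_neg_Ioi M).mul_const _) (hI.mono_set hsub)
          measurableSet_Ioi fun t ht => ?_
        gcongr
        exact le_of_lt ht
    _ ≤ _ := by
        refine setIntegral_mono_set hI ?_ hsub.eventuallyLE
        filter_upwards [ae_restrict_mem measurableSet_Ioi] with t ht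
        have : 0 < t := ht
        positivity

theorem summable_pochCoeff_div_Gamma {α b γ : ℝ} (hα : 0 < α) (hb : 0 < b) (z : ℝ) :
    Summable fun k : ℕ => pochCoeff γ k * z ^ k / Real.Gamma (α * k + b) := by
  -- With M^α = |z| + 1, the terms are dominated by a multiple of the binomial series at |z| / (|z|
  -- + 1) < 1.
  set M : ℝ := (|z| + 1) ^ (1 / α) with hMdef
  have hM : 0 < M := by positivity
  have hMα : M ^ α = |z| + 1 := by
    rw [hMdef, ← Real.rpow_mul (by positivity), one_div_mul_cancel hα.ne', Real.rpow_one]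
  have hq : |(|z| / (|z| + 1))| < 1 := by
    rw [abs_of_nonneg (by positivity), div_lt_one (by positivity)]; linarith
  have hs := ((summable_pochCoeff_mul_pow γ hq).norm).mul_left (Real.exp M * M ^ (1 - b))
  refine Summable.of_norm_bounded_eventually_nat hs ?_
  have hev : ∀ᶠ k : ℕ in atTop, 1 ≤ α * k := by
    have := (tendsto_natCast_atTop_atTop (R := ℝ)).const_mul_atTop hα
    exact this.eventually_ge_atTop 1
  filter_upwards [hev] with k hk
  have hG := exp_neg_mul_rpow_le_Gamma hM (x := α * k + b) (by linarith)
  have hp : 0 < Real.exp (-M) * M ^ (α * k + b - 1) := by positivity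
  rw [norm_div, norm_mul, norm_mul, Real.norm_of_nonneg (r := Real.Gamma _) (hp.le.trans hG)]
  calc _ ≤ ‖pochCoeff γ k‖ * ‖z ^ k‖ / (Real.exp (-M) * M ^ (α * k + b - 1)) := by gcongr
    _ = _ := by
      have e1 : M ^ (α * k + b - 1) = (|z| + 1) ^ k / M ^ (1 - b) := by
        rw [← hMα, ← Real.rpow_natCast, ← Real.rpow_mul hM.le, ← Real.rpow_sub hM]
        congr 1; ring
      rw [e1, Real.exp_neg, norm_pow, norm_pow, norm_div, div_pow, Real.norm_eq_abs |z|, abs_abs,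
        Real.norm_of_nonneg (r := |z| + 1) (by positivity), Real.norm_eq_abs z]
      field_simp

theorem mittagLeffler_eq_tsum (a b γ z : ℝ) :
    mittagLeffler a b γ z = ∑' k : ℕ, pochCoeff γ k * z ^ k / Real.Gamma (a * k + b) := by
  unfold mittagLeffler pochCoeff
  congr 1 with k
  field_simp

theorem continuous_mittagLeffler {α b γ : ℝ} (hα : 0 < α) (hb : 0 < b) :
    Continuous (mittagLeffler α b γ) := by
  have : mittagLeffler α b γ = fun z => ∑' k : ℕ, pochCoeff γ k * z ^ k / Real.Gamma (α * k + b) :=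
    funext fun z => mittagLeffler_eq_tsum _ _ _ _
  rw [this, continuous_iff_continuousAt]
  intro z
  have hz : Metric.ball (0 : ℝ) (|z| + 1) ∈ 𝓝 z := Metric.isOpen_ball.mem_nhds (by simp)
  refine ContinuousOn.continuousAt (continuousOn_tsum (fun k => by fun_prop)
    (summable_pochCoeff_div_Gamma (γ := γ) hα hb (|z| + 1)).norm fun k x hx => ?_) hz
  rw [norm_div, norm_div, norm_mul, norm_mul, norm_pow, norm_pow]
  gcongr
  rw [Real.norm_of_nonneg (r := |z| + 1) (by positivity)]
  simpa using (mem_ball_zero_iff.1 hx).le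

theorem mittagLeffler_zero (α b γ : ℝ) : mittagLeffler α b γ 0 = 1 / Real.Gamma b := by
  rw [mittagLeffler_eq_tsum, tsum_eq_single 0]
  · simp [pochCoeff]
  · intro k hk; simp [hk]

/-! ### Beta integrals and the convolution of Prabhakar kernels -/

theorem intervalIntegrable_sub_rpow_mul_rpow {x y t : ℝ} (hx : 0 < x) (hy : 0 < y) (ht : 0 < t) :
    IntervalIntegrable (fun s => (t - s) ^ (x - 1) * s ^ (y - 1)) volume 0 t := by
  -- Cutting at t/2 leaves at most one singular factor on each half.
  have h1 : IntervalIntegrable (fun s => (t - s) ^ (x - 1) * s ^ (y - 1)) volume 0 (t / 2) := by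
    refine (intervalIntegral.intervalIntegrable_rpow' (by linarith)).continuousOn_mul ?_
    refine ContinuousOn.rpow_const (by fun_prop) fun s hs => Or.inl ?_
    rw [uIcc_of_le (by linarith)] at hs
    linarith [hs.2]
  have h2 : IntervalIntegrable (fun s => (t - s) ^ (x - 1) * s ^ (y - 1)) volume (t / 2) t := by
    have h3 : IntervalIntegrable (fun s => (t - s) ^ (x - 1)) volume (t / 2) t := by
      have h4 := (intervalIntegral.intervalIntegrable_rpow' (a := t / 2) (b := 0)
        (r := x - 1) (by linarith)).comp_sub_left t
      simpa [sub_half] using h4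
    refine h3.mul_continuousOn ?_
    refine ContinuousOn.rpow_const (by fun_prop) fun s hs => Or.inl ?_
    rw [uIcc_of_le (by linarith)] at hs
    linarith [hs.1]
  exact h1.trans h2

theorem integral_sub_rpow_mul_rpow {x y t : ℝ} (hx : 0 < x) (hy : 0 < y) (ht : 0 < t) :
    ∫ s in 0..t, (t - s) ^ (x - 1) * s ^ (y - 1) =
      t ^ (x + y - 1) * (Real.Gamma x * Real.Gamma y / Real.Gamma (x + y)) := by
  have h := Complex.betaIntegral_scaled (y : ℂ) (x : ℂ) ht
  rw [Complex.betaIntegral_eq_Gamma_mul_div _ _ (by simpa) (by simpa)] at h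
  have h2 : ∫ s : ℝ in 0..t, (s : ℂ) ^ ((y : ℂ) - 1) * ((t : ℂ) - s) ^ ((x : ℂ) - 1) =
      ∫ s : ℝ in 0..t, (((t - s) ^ (x - 1) * s ^ (y - 1) : ℝ) : ℂ) := by
    refine intervalIntegral.integral_congr fun s hs => ?_
    rw [uIcc_of_le ht.le] at hs
    rw [Complex.ofReal_mul, Complex.ofReal_cpow hs.1, Complex.ofReal_cpow (sub_nonneg.2 hs.2)]
    push_cast
    ring
  rw [h2, intervalIntegral.integral_ofReal] at h
  rw [show (t : ℂ) ^ ((y : ℂ) + x - 1) = ((t ^ (x + y - 1) : ℝ) : ℂ) by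
    rw [Complex.ofReal_cpow ht.le]; push_cast; ring_nf] at h
  rw [← Complex.ofReal_add, Complex.Gamma_ofReal, Complex.Gamma_ofReal, Complex.Gamma_ofReal] at h
  rw [mul_comm (Real.Gamma x), add_comm x y]
  rw [add_comm x y] at h
  exact_mod_cast h

/-- The Prabhakar kernel `t^(b-1) E^γ_{(α,b)}(-c t^α)`. -/
noncomputable def prabhakar (α c γ b t : ℝ) : ℝ :=
  t ^ (b - 1) * mittagLeffler α b γ (-c * t ^ α)

/-- The `k`-th term of the power series of the Prabhakar kernel. -/
noncomputable def prabhakarTerm (α c γ b : ℝ) (k : ℕ) (t : ℝ) : ℝ :=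
  pochCoeff γ k * (-c) ^ k * t ^ (α * k + b - 1) / Real.Gamma (α * k + b)

section
variable {α c γ δ b d t : ℝ}

theorem mlDensity_of_pos {x : ℝ} (hx : 0 < x) :
    mlDensity α γ x = γ ^ γ * prabhakar α γ γ (α * γ) x := by
  rw [mlDensity, if_pos hx, prabhakar]; ring

theorem prabhakarTerm_eq (ht : 0 < t) (k : ℕ) : prabhakarTerm α c γ b k t =
    t ^ (b - 1) * (pochCoeff γ k * (-c * t ^ α) ^ k / Real.Gamma (α * k + b)) := by
  rw [prabhakarTerm, mul_pow, ← Real.rpow_natCast (t ^ α), ← Real.rpow_mul ht.le,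
    show α * k + b - 1 = (b - 1) + α * k by ring, Real.rpow_add ht]
  ring

theorem summable_prabhakarTerm (hα : 0 < α) (hb : 0 < b) (ht : 0 < t) :
    Summable fun k => prabhakarTerm α c γ b k t := by
  simp_rw [prabhakarTerm_eq ht]
  exact (summable_pochCoeff_div_Gamma hα hb _).mul_left _

theorem tsum_prabhakarTerm (ht : 0 < t) :
    ∑' k, prabhakarTerm α c γ b k t = prabhakar α c γ b t := by
  simp_rw [prabhakarTerm_eq ht]
  rw [tsum_mul_left, prabhakar, mittagLeffler_eq_tsum]

theorem continuousOn_prabhakar (hα : 0 < α) (hb : 0 < b) :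
    ContinuousOn (prabhakar α c γ b) (Ioi 0) := by
  have h : ∀ r : ℝ, ContinuousOn (fun t : ℝ => t ^ r) (Ioi 0) := fun r =>
    ContinuousOn.rpow_const continuousOn_id fun t ht => Or.inl (ne_of_gt ht)
  exact (h _).mul ((continuous_mittagLeffler hα hb).comp_continuousOn
    (continuousOn_const.mul (h _)))

theorem continuous_mittagLeffler_rpow (hα : 0 < α) (hb : 0 < b) :
    Continuous fun t : ℝ => mittagLeffler α b γ (-c * t ^ α) :=
  (continuous_mittagLeffler hα hb).comp
    (continuous_const.mul (Real.continuous_rpow_const hα.le))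

theorem intervalIntegrable_prabhakar_conv (hα : 0 < α) (hb : 0 < b) (hd : 0 < d) (ht : 0 < t) :
    IntervalIntegrable (fun s => prabhakar α c γ b (t - s) * prabhakar α c δ d s) volume 0 t := by
  have h := (intervalIntegrable_sub_rpow_mul_rpow hb hd ht).mul_continuousOn
    (g := fun s => mittagLeffler α b γ (-c * (t - s) ^ α) * mittagLeffler α d δ (-c * s ^ α))
    (((continuous_mittagLeffler_rpow (c := c) hα hb).comp (continuous_sub_left t)).mul
      (continuous_mittagLeffler_rpow hα hd)).continuousOn
  refine h.congr fun s _ => ?_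
  simp only [prabhakar]
  ring

theorem intervalIntegrable_prabhakar (hα : 0 < α) (hb : 0 < b) (t : ℝ) :
    IntervalIntegrable (prabhakar α c γ b) volume 0 t :=
  (intervalIntegral.intervalIntegrable_rpow' (by linarith)).mul_continuousOn
    (continuous_mittagLeffler_rpow hα hb).continuousOn

theorem prabhakarTerm_conv (hα : 0 < α) (hb : 0 < b) (hd : 0 < d) (ht : 0 < t) (i j : ℕ) :
    ∫ s in 0..t, (t - s) ^ (α * i + b - 1) * s ^ (α * j + d - 1) =
      Real.Gamma (α * i + b) * Real.Gamma (α * j + d) *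
        (t ^ (α * (i + j : ℕ) + (b + d) - 1) / Real.Gamma (α * (i + j : ℕ) + (b + d))) := by
  rw [integral_sub_rpow_mul_rpow (by positivity) (by positivity) ht]
  push_cast
  rw [show α * i + b + (α * j + d) = α * (i + j) + (b + d) by ring]
  ring

/-- The Prabhakar kernels form a convolution semigroup. -/
theorem integral_prabhakar_conv (hα : 0 < α) (hc : 0 ≤ c) (hγ : 0 ≤ γ) (hδ : 0 ≤ δ)
    (hb : 0 < b) (hd : 0 < d) (ht : 0 < t) :
    ∫ s in 0..t, prabhakar α c γ b (t - s) * prabhakar α c δ d s =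
      prabhakar α c (γ + δ) (b + d) t := by
  set K : ℕ × ℕ → ℝ := fun p => pochCoeff γ p.1 * pochCoeff δ p.2 with hK
  have hK0 : ∀ p, 0 ≤ K p := fun p => mul_nonneg (pochCoeff_nonneg hγ _) (pochCoeff_nonneg hδ _)
  have hG : ∀ (k : ℕ) {e : ℝ}, 0 < e → 0 < Real.Gamma (α * k + e) := fun k e he =>
    Real.Gamma_pos_of_pos (by positivity)
  set T : ℕ → ℝ := fun k =>
    t ^ (α * k + (b + d) - 1) / Real.Gamma (α * k + (b + d)) with hT
  have hT0 : ∀ k, 0 ≤ T k := fun k => div_nonneg (by positivity) (hG k (by positivity)).le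
  set F : ℕ × ℕ → ℝ → ℝ := fun p s =>
    prabhakarTerm α c γ b p.1 (t - s) * prabhakarTerm α c δ d p.2 s with hF
  have hFe : ∀ p s, F p s = K p * (-c) ^ (p.1 + p.2) /
      (Real.Gamma (α * p.1 + b) * Real.Gamma (α * p.2 + d)) *
      ((t - s) ^ (α * p.1 + b - 1) * s ^ (α * p.2 + d - 1)) := by
    intro p s
    simp only [hF, prabhakarTerm, hK, pow_add]
    field_simp
  have hii : ∀ p : ℕ × ℕ, IntervalIntegrable
      (fun s => (t - s) ^ (α * p.1 + b - 1) * s ^ (α * p.2 + d - 1)) volume 0 t := fun p =>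
    intervalIntegrable_sub_rpow_mul_rpow (by positivity) (by positivity) ht
  have hint : ∀ p, ∫ s in 0..t, F p s = K p * (-c) ^ (p.1 + p.2) * T (p.1 + p.2) := by
    intro p
    simp_rw [hFe]
    rw [intervalIntegral.integral_const_mul, prabhakarTerm_conv hα hb hd ht]
    have := (hG p.1 hb).ne'
    have := (hG p.2 hd).ne'
    simp only [hT]
    field_simp
  have hnorm : ∀ p, ∫ s in 0..t, ‖F p s‖ = K p * c ^ (p.1 + p.2) * T (p.1 + p.2) := by
    intro p
    have : ∀ s ∈ uIcc 0 t, ‖F p s‖ = K p * c ^ (p.1 + p.2) /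
      (Real.Gamma (α * p.1 + b) * Real.Gamma (α * p.2 + d)) *
      ((t - s) ^ (α * p.1 + b - 1) * s ^ (α * p.2 + d - 1)) := by
      intro s hs
      rw [uIcc_of_le ht.le] at hs
      have h1 := hs.1
      have h2 := sub_nonneg.2 hs.2
      have := hG p.1 hb
      have := hG p.2 hd
      rw [hFe, norm_mul, norm_div, norm_mul, norm_pow, norm_neg, Real.norm_of_nonneg hc,
        Real.norm_of_nonneg (hK0 p), Real.norm_of_nonneg (by positivity),
        Real.norm_of_nonneg (by positivity)]
    rw [intervalIntegral.integral_congr this]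
    rw [intervalIntegral.integral_const_mul, prabhakarTerm_conv hα hb hd ht]
    have := (hG p.1 hb).ne'
    have := (hG p.2 hd).ne'
    simp only [hT]
    field_simp
  -- The Beta integral depends on (i, j) only through i + j, so each antidiagonal collapses by
  -- `pochCoeff_add`.
  have hanti : ∀ (x : ℝ) (k : ℕ), ∑ p ∈ Finset.HasAntidiagonal.antidiagonal k,
      K p * x ^ (p.1 + p.2) * T (p.1 + p.2) = pochCoeff (γ + δ) k * x ^ k * T k := by
    intro x k
    rw [pochCoeff_add, Finset.sum_mul, Finset.sum_mul]
    refine Finset.sum_congr rfl fun p hp => ?_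
    rw [Finset.HasAntidiagonal.mem_antidiagonal.1 hp]
  have hterm : ∀ (x : ℝ) (k : ℕ), prabhakarTerm α (-x) (γ + δ) (b + d) k t =
      pochCoeff (γ + δ) k * x ^ k * T k := fun x k => by
    simp only [prabhakarTerm, hT, neg_neg]; ring
  -- The integrated norms are the terms with -c replaced by c, so their sum is the convergent series
  -- of a kernel with parameter -c.
  have hsumm : Summable fun p : ℕ × ℕ => K p * c ^ (p.1 + p.2) * T (p.1 + p.2) := by
    rw [← Finset.HasAntidiagonal.sigmaAntidiagonalEquivProd.summable_iff]
    refine (summable_sigma_of_nonneg fun x => ?_).2 ⟨fun k => (hasSum_fintype _).summable, ?_⟩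
    · exact mul_nonneg (mul_nonneg (hK0 _) (by positivity)) (hT0 _)
    · refine (summable_prabhakarTerm (c := -c) (γ := γ + δ) hα (add_pos hb hd) ht).congr fun k => ?_
      rw [hterm, ← hanti, tsum_fintype]
      exact (Finset.sum_coe_sort _ _).symm
  have hae : ∀ᵐ s ∂volume.restrict (Ioc 0 t), s ∈ Ioo 0 t := by
    rw [← Measure.restrict_congr_set Ioo_ae_eq_Ioc]
    exact ae_restrict_mem measurableSet_Ioo
  have hsum := hasSum_integral_of_summable_integral_norm (μ := volume.restrict (Ioc 0 t)) (F := F)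
    (fun p => by
      have := (hii p).const_mul (K p * (-c) ^ (p.1 + p.2) /
        (Real.Gamma (α * p.1 + b) * Real.Gamma (α * p.2 + d)))
      simp_rw [← hFe] at this
      exact (intervalIntegrable_iff_integrableOn_Ioc_of_le ht.le).1 this)
    (by
      simp_rw [← intervalIntegral.integral_of_le ht.le, hnorm]
      exact hsumm)
  simp_rw [← intervalIntegral.integral_of_le ht.le, hint] at hsum
  have hrhs : HasSum (fun p : ℕ × ℕ => K p * (-c) ^ (p.1 + p.2) * T (p.1 + p.2))
      (prabhakar α c (γ + δ) (b + d) t) := by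
    have hs' : Summable fun p : ℕ × ℕ => K p * (-c) ^ (p.1 + p.2) * T (p.1 + p.2) := by
      refine Summable.of_norm (hsumm.congr fun p => ?_)
      rw [norm_mul, norm_mul, norm_pow, norm_neg, Real.norm_of_nonneg hc,
        Real.norm_of_nonneg (hK0 p), Real.norm_of_nonneg (hT0 _)]
    have h1 := hs'.hasSum
    have h2 := ((Finset.HasAntidiagonal.sigmaAntidiagonalEquivProd).hasSum_iff.2 h1).sigma
      (fun k => hasSum_fintype _)
    convert h1
    rw [← h2.tsum_eq, ← tsum_prabhakarTerm ht]
    refine tsum_congr fun k => ?_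
    have := hterm (-c) k
    rw [neg_neg] at this
    rw [this, ← hanti]
    exact (Finset.sum_coe_sort _ _).symm
  rw [← hsum.unique hrhs]
  simp_rw [intervalIntegral.integral_of_le ht.le]
  refine integral_congr_ae ?_
  filter_upwards [hae] with s hs
  have hs' : 0 < t - s := sub_pos.2 hs.2
  rw [← tsum_prabhakarTerm hs', ← tsum_prabhakarTerm hs.1]
  exact tsum_mul_tsum_of_summable_norm (summable_prabhakarTerm hα hb hs').norm
    (summable_prabhakarTerm hα hd hs.1).norm

/-- At γ = 0 the kernel is that of fractional integration: convolving with it raises b and keeps γ.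
-/
theorem prabhakar_zero (t : ℝ) :
    prabhakar α c 0 b t = t ^ (b - 1) / Real.Gamma b := by
  rw [prabhakar, mittagLeffler_eq_tsum, tsum_eq_single 0]
  · simp [pochCoeff_zero_right]; ring
  · rintro (_ | k) hk
    · exact absurd rfl hk
    · simp [pochCoeff_zero_succ]

/-- On the Laplace side, -d/ds (s^α + c)^(-γ) = αγ s^(α-1) (s^α + c)^(-γ-1); here it is checked
coefficient by coefficient. -/
theorem mul_prabhakar (hα : 0 < α) (hγ : 0 < γ) (ht : 0 < t) :
    t * prabhakar α c γ (α * γ) t = α * γ * prabhakar α c (γ + 1) (α * γ + 1) t := by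
  rw [← tsum_prabhakarTerm ht, ← tsum_prabhakarTerm ht, ← tsum_mul_left, ← tsum_mul_left]
  refine tsum_congr fun k => ?_
  have h0 : 0 < α * k + α * γ := by positivity
  have hG := Real.Gamma_pos_of_pos h0
  simp only [prabhakarTerm]
  rw [show α * k + (α * γ + 1) = (α * k + α * γ) + 1 by ring, Real.Gamma_add_one h0.ne',
    add_sub_cancel_right, Real.rpow_sub_one ht.ne']
  have h1 := add_mul_pochCoeff γ k
  have h2 : (k + γ : ℝ) ≠ 0 := by positivity
  have h3 : pochCoeff γ k = γ * pochCoeff (γ + 1) k / (k + γ) := by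
    rw [← h1]; field_simp
  rw [h3]
  have h4 : α * k + α * γ = α * (k + γ) := by ring
  rw [h4] at *
  field_simp

theorem prabhakar_one_one (hα : 0 < α) (ht : 0 < t) :
    prabhakar α c 1 1 t = 1 - c * prabhakar α c 1 (α + 1) t := by
  rw [← tsum_prabhakarTerm ht, ← tsum_prabhakarTerm ht,
    (summable_prabhakarTerm hα one_pos ht).tsum_eq_zero_add, ← tsum_mul_left, sub_eq_add_neg,
    ← tsum_neg]
  congr 1
  · simp [prabhakarTerm, pochCoeff_zero_right]
  · refine tsum_congr fun k => ?_
    simp only [prabhakarTerm, pochCoeff_one]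
    push_cast
    rw [show α * (k + 1) + 1 = α * k + (α + 1) by ring]
    ring

end

/-! ### Positivity and an upper bound -/

/-- Otherwise the points of [ε, x] where P ≤ 0 form a nonempty compact set, and `hstep` fails at its
least element. -/
theorem forall_pos_of_pos_left {P : ℝ → ℝ} (hc : ContinuousOn P (Ioi 0))
    (h0 : ∀ᶠ x in 𝓝[>] 0, 0 < P x)
    (hstep : ∀ x > 0, (∀ y ∈ Ioo 0 x, 0 < P y) → 0 < P x) {x : ℝ} (hx : 0 < x) : 0 < P x := by
  by_contra! hneg
  obtain ⟨ε, hε, hεP⟩ := mem_nhdsGT_iff_exists_Ioo_subset.1 h0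
  have hεP' : ∀ y ∈ Ioo 0 ε, 0 < P y := fun y hy => hεP hy
  have hcl : IsClosed (Icc ε x ∩ P ⁻¹' Iic 0) :=
    (hc.mono fun y hy => lt_of_lt_of_le hε hy.1).preimage_isClosed_of_isClosed
      isClosed_Icc isClosed_Iic
  have hxε : ε ≤ x := by
    by_contra! hlt
    exact absurd (hεP' x ⟨hx, hlt⟩) hneg.not_gt
  obtain ⟨m, hm, hmin⟩ := (isCompact_Icc.of_isClosed_subset hcl inter_subset_left).exists_isLeast
    ⟨x, ⟨hxε, le_rfl⟩, hneg⟩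
  refine absurd (hstep m (lt_of_lt_of_le hε hm.1.1) fun y hy => ?_) (not_lt.2 hm.2)
  by_contra! hy0
  rcases lt_or_ge y ε with h | h
  · exact absurd (hεP' y ⟨hy.1, h⟩) hy0.not_gt
  · exact absurd (hmin ⟨⟨h, hy.2.le.trans hm.1.2⟩, hy0⟩) hy.2.not_ge

section
variable {α c γ b t : ℝ}

theorem eventually_prabhakar_pos (hα : 0 < α) (hb : 0 < b) :
    ∀ᶠ t in 𝓝[>] 0, 0 < prabhakar α c γ b t := by
  have h : Tendsto (fun t : ℝ => mittagLeffler α b γ (-c * t ^ α)) (𝓝[>] 0)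
      (𝓝 (1 / Real.Gamma b)) := by
    have := (continuous_mittagLeffler_rpow (c := c) (γ := γ) hα hb).tendsto 0
    rw [Real.zero_rpow hα.ne', mul_zero, mittagLeffler_zero] at this
    exact this.mono_left nhdsWithin_le_nhds
  have hpos : 0 < 1 / Real.Gamma b := one_div_pos.2 (Real.Gamma_pos_of_pos hb)
  filter_upwards [h.eventually_const_lt hpos, self_mem_nhdsWithin] with t ht ht0
  exact mul_pos (Real.rpow_pos_of_pos ht0 _) ht

/-- The parameters split as (γ + 1, αγ + 1) = (1, 1) + (γ, αγ). This Volterra equation gives both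
positivity and the upper bound. -/
theorem mul_prabhakar_eq_conv (hα : 0 < α) (hc : 0 ≤ c) (hγ : 0 < γ) (ht : 0 < t) :
    t * prabhakar α c γ (α * γ) t =
      α * γ * ∫ s in 0..t, prabhakar α c 1 1 (t - s) * prabhakar α c γ (α * γ) s := by
  rw [mul_prabhakar hα hγ ht, integral_prabhakar_conv hα hc zero_le_one hγ.le one_pos
    (mul_pos hα hγ) ht, add_comm γ, add_comm (α * γ)]

/-- The two kernels must be handled together: the Volterra equation gives e_{1,α}(x) > 0 from both
on (0, x), and e_{1,1} is the fractional integral of order 1 - α > 0 of e_{1,α}. -/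
theorem prabhakar_one_pos (hα0 : 0 < α) (hα1 : α < 1) (hc : 0 ≤ c) (ht : 0 < t) :
    0 < prabhakar α c 1 1 t ∧ 0 < prabhakar α c 1 α t := by
  rw [← lt_min_iff]
  refine forall_pos_of_pos_left (P := fun t => min (prabhakar α c 1 1 t) (prabhakar α c 1 α t))
    (ContinuousOn.inf (continuousOn_prabhakar hα0 one_pos) (continuousOn_prabhakar hα0 hα0)) ?_ ?_ ht
  · filter_upwards [eventually_prabhakar_pos hα0 one_pos, eventually_prabhakar_pos hα0 hα0]
      with t h1 h2 using lt_min h1 h2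
  · intro x hx hpos
    simp only [lt_min_iff] at hpos ⊢
    have hg : 0 < prabhakar α c 1 α x := by
      have h := mul_prabhakar_eq_conv hα0 hc one_pos hx
      rw [mul_one] at h
      refine pos_of_mul_pos_right (h ▸ ?_ : 0 < x * prabhakar α c 1 α x) hx.le
      refine mul_pos hα0 (intervalIntegral.intervalIntegral_pos_of_pos_on
        (intervalIntegrable_prabhakar_conv hα0 one_pos hα0 hx) (fun s hs => ?_) hx)
      exact mul_pos (hpos _ ⟨sub_pos.2 hs.2, sub_lt_self _ hs.1⟩).1 (hpos s hs).2
    refine ⟨?_, hg⟩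
    have h := integral_prabhakar_conv hα0 hc le_rfl zero_le_one (sub_pos.2 hα1) hα0 hx
    rw [zero_add, sub_add_cancel] at h
    rw [← h]
    refine intervalIntegral.intervalIntegral_pos_of_pos_on
      (intervalIntegrable_prabhakar_conv hα0 (sub_pos.2 hα1) hα0 hx) (fun s hs => ?_) hx
    rw [prabhakar_zero]
    exact mul_pos (div_pos (Real.rpow_pos_of_pos (sub_pos.2 hs.2) _)
      (Real.Gamma_pos_of_pos (sub_pos.2 hα1))) (hpos s hs).2

/-- The deficit 1 - e_{1,1} is c e_{1,α+1}, and e_{1,α+1} is the integral of the positive e_{1,α}.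
-/
theorem prabhakar_one_one_lt_one (hα0 : 0 < α) (hα1 : α < 1) (hc : 0 < c) (ht : 0 < t) :
    prabhakar α c 1 1 t < 1 := by
  rw [prabhakar_one_one hα0 ht]
  have h := integral_prabhakar_conv hα0 hc.le le_rfl zero_le_one one_pos hα0 ht
  rw [zero_add, add_comm 1 α] at h
  have h2 : 0 < prabhakar α c 1 (α + 1) t := by
    rw [← h]
    refine intervalIntegral.intervalIntegral_pos_of_pos_on
      (intervalIntegrable_prabhakar_conv hα0 one_pos hα0 ht) (fun s hs => ?_) ht
    rw [prabhakar_zero]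
    exact mul_pos (by simp) (prabhakar_one_pos hα0 hα1 hc.le hs.1).2
  linarith [mul_pos hc h2]

theorem prabhakar_pos (hα0 : 0 < α) (hα1 : α < 1) (hc : 0 ≤ c) (hγ : 0 < γ) (ht : 0 < t) :
    0 < prabhakar α c γ (α * γ) t := by
  have hb : 0 < α * γ := mul_pos hα0 hγ
  refine forall_pos_of_pos_left (continuousOn_prabhakar hα0 hb)
    (eventually_prabhakar_pos hα0 hb) (fun x hx hpos => ?_) ht
  refine pos_of_mul_pos_right (?_ : 0 < x * prabhakar α c γ (α * γ) x) hx.le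
  rw [mul_prabhakar_eq_conv hα0 hc hγ hx]
  refine mul_pos hb (intervalIntegral.intervalIntegral_pos_of_pos_on
    (intervalIntegrable_prabhakar_conv hα0 one_pos hb hx) (fun s hs => ?_) hx)
  exact mul_pos (prabhakar_one_pos hα0 hα1 hc (sub_pos.2 hs.2)).1 (hpos s hs)

/-- The maximum m(x) on [0, t] sits at 0. If x > 0, the Volterra equation and e_{1,1} < 1 give
x^(αγ) m(x) < αγ ∫_0^x s^(αγ-1) m(x) ds = x^(αγ) m(x). -/
theorem mittagLeffler_le (hα0 : 0 < α) (hα1 : α < 1) (hc : 0 < c) (hγ : 0 < γ) (ht : 0 ≤ t) :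
    mittagLeffler α (α * γ) γ (-c * t ^ α) ≤ 1 / Real.Gamma (α * γ) := by
  have hb : 0 < α * γ := mul_pos hα0 hγ
  set m : ℝ → ℝ := fun t => mittagLeffler α (α * γ) γ (-c * t ^ α) with hm
  have hm0 : m 0 = 1 / Real.Gamma (α * γ) := by
    simp only [hm]; rw [Real.zero_rpow hα0.ne', mul_zero, mittagLeffler_zero]
  obtain ⟨x, hx, hmax⟩ := isCompact_Icc.exists_isMaxOn (nonempty_Icc.2 ht)
    (continuous_mittagLeffler_rpow (c := c) (γ := γ) hα0 hb).continuousOn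
  have hmt : m t ≤ m x := hmax ⟨ht, le_rfl⟩
  rcases hx.1.eq_or_lt with rfl | hx0
  · rw [← hm0]; exact hmt
  exfalso
  have h1 := mul_prabhakar_eq_conv hα0 hc.le hγ hx0
  have hI1 := intervalIntegrable_prabhakar_conv (c := c) (γ := 1) (δ := γ) hα0 one_pos hb hx0
  have hI2 := intervalIntegrable_prabhakar (c := c) (γ := γ) hα0 hb x
  have h2 : 0 < ∫ s in 0..x, (prabhakar α c γ (α * γ) s -
      prabhakar α c 1 1 (x - s) * prabhakar α c γ (α * γ) s) := by
    refine intervalIntegral.intervalIntegral_pos_of_pos_on (hI2.sub hI1) (fun s hs => ?_) hx0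
    have h3 := prabhakar_one_one_lt_one hα0 hα1 hc (sub_pos.2 hs.2)
    have h4 := prabhakar_pos hα0 hα1 hc.le hγ hs.1
    nlinarith
  rw [intervalIntegral.integral_sub hI2 hI1] at h2
  have h3 : ∫ s in 0..x, prabhakar α c γ (α * γ) s ≤ ∫ s in 0..x, s ^ (α * γ - 1) * m x := by
    refine intervalIntegral.integral_mono_on hx0.le hI2
      ((intervalIntegral.intervalIntegrable_rpow' (by linarith)).mul_const _) fun s hs => ?_
    exact mul_le_mul_of_nonneg_left (hmax ⟨hs.1, hs.2.trans hx.2⟩) (Real.rpow_nonneg hs.1 _)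
  rw [intervalIntegral.integral_mul_const, integral_rpow (Or.inl (by linarith)), sub_add_cancel,
    Real.zero_rpow hb.ne', sub_zero] at h3
  have h4 : x * prabhakar α c γ (α * γ) x = x ^ (α * γ) * m x := by
    change x * (x ^ (α * γ - 1) * m x) = _
    rw [Real.rpow_sub_one hx0.ne']; field_simp
  have h5 : α * γ * ∫ s in 0..x, prabhakar α c γ (α * γ) s ≤ x ^ (α * γ) * m x := by
    calc _ ≤ α * γ * (x ^ (α * γ) / (α * γ) * m x) := by gcongr
      _ = _ := by field_simp
  nlinarith

theorem prabhakar_le (hα0 : 0 < α) (hα1 : α < 1) (hc : 0 < c) (hγ : 0 < γ) (ht : 0 < t) :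
    prabhakar α c γ (α * γ) t ≤ 1 / Real.Gamma (α * γ) * t ^ (α * γ - 1) := by
  rw [prabhakar, mul_comm]
  gcongr
  exact mittagLeffler_le hα0 hα1 hc hγ ht.le

end

/-! ### First properties of the density -/

section
variable {α γ x : ℝ}

theorem mlDensity_of_nonpos (hx : x ≤ 0) : mlDensity α γ x = 0 := if_neg hx.not_gt

theorem mlDensity_nonneg (hα0 : 0 < α) (hα1 : α < 1) (hγ : 0 < γ) (x : ℝ) :
    0 ≤ mlDensity α γ x := by
  rcases lt_or_ge 0 x with hx | hx
  · rw [mlDensity_of_pos hx]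
    exact mul_nonneg (by positivity) (prabhakar_pos hα0 hα1 hγ.le hγ hx).le
  · rw [mlDensity_of_nonpos hx]

theorem mlDensity_le (hα0 : 0 < α) (hα1 : α < 1) (hγ : 0 < γ) (hx : 0 < x) :
    mlDensity α γ x ≤ γ ^ γ / Real.Gamma (α * γ) * x ^ (α * γ - 1) := by
  rw [mlDensity_of_pos hx]
  calc _ ≤ γ ^ γ * (1 / Real.Gamma (α * γ) * x ^ (α * γ - 1)) := by
        gcongr; exact prabhakar_le hα0 hα1 hγ hγ hx
    _ = _ := by ring

theorem continuousOn_mlDensity (hα : 0 < α) (hγ : 0 < γ) :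
    ContinuousOn (mlDensity α γ) (Ioi 0) :=
  (continuousOn_const.mul (continuousOn_prabhakar hα (mul_pos hα hγ))).congr
    fun _ hx => mlDensity_of_pos hx

end

/-! ### Laplace transforms of functions on the half-line -/

section
variable {f : ℝ → ℝ} {Φ : ℂ → ℂ}

theorem norm_exp_neg_mul_ofReal (s : ℂ) (x : ℝ) :
    ‖Complex.exp (-s * x)‖ = Real.exp (-s.re * x) := by
  rw [Complex.norm_exp]; simp

theorem laplaceTransform_ofReal (f : ℝ → ℝ) (ε : ℝ) :
    laplaceTransform f ε = ((∫ x in Ioi 0, Real.exp (-ε * x) * f x : ℝ) : ℂ) := by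
  rw [← integral_complex_ofReal]
  simp [laplaceTransform]

theorem tendsto_laplaceTransform (hf : IntegrableOn f (Ioi 0)) {s : ℂ} {σ : ℕ → ℂ}
    (hσ0 : ∀ n, 0 ≤ (σ n).re) (hσ : Tendsto σ atTop (𝓝 s)) :
    Tendsto (fun n => laplaceTransform f (σ n)) atTop (𝓝 (laplaceTransform f s)) := by
  refine tendsto_integral_of_dominated_convergence (fun x => ‖f x‖) (fun n => ?_) hf.norm
    (fun n => ?_) ?_
  · exact (by fun_prop : Continuous fun x : ℝ => Complex.exp (-σ n * x)).aestronglyMeasurable.mul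
      (Complex.continuous_ofReal.comp_aestronglyMeasurable hf.aestronglyMeasurable)
  · filter_upwards [ae_restrict_mem measurableSet_Ioi] with x hx
    rw [norm_mul, norm_exp_neg_mul_ofReal, Complex.norm_real]
    refine mul_le_of_le_one_left (norm_nonneg _) (Real.exp_le_one_iff.2 ?_)
    exact mul_nonpos_of_nonpos_of_nonneg (by linarith [hσ0 n]) (le_of_lt hx)
  · refine ae_of_all _ fun x => ?_
    exact (((Complex.continuous_exp.tendsto _).comp
      (hσ.neg.mul_const (x : ℂ))).mul_const (f x : ℂ))

/-- A nonnegative function whose Laplace transform on the open half-plane extends continuously to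
the closed half-plane, with value `1` at `0`, is a probability density. -/
theorem isPositiveDensity_and_laplace (h0 : ∀ x ≤ 0, f x = 0) (hn : ∀ x, 0 ≤ f x)
    (hI : ∀ ε > 0, IntegrableOn (fun x => Real.exp (-ε * x) * f x) (Ioi 0))
    (hΦ : ∀ s : ℂ, 0 ≤ s.re → ContinuousAt Φ s) (hΦ0 : Φ 0 = 1)
    (hL : ∀ s : ℂ, 0 < s.re → laplaceTransform f s = Φ s) :
    IsPositiveDensity f ∧ ∀ s : ℂ, 0 ≤ s.re → laplaceTransform f s = Φ s := by
  have hε : Tendsto (fun n : ℕ => 1 / ((n : ℝ) + 1)) atTop (𝓝 0) :=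
    tendsto_one_div_add_atTop_nhds_zero_nat
  have hεp : ∀ n : ℕ, 0 < 1 / ((n : ℝ) + 1) := fun n => by positivity
  have hσ : ∀ s : ℂ, Tendsto (fun n : ℕ => s + ((1 / ((n : ℝ) + 1) : ℝ) : ℂ)) atTop (𝓝 s) := by
    intro s
    simpa using tendsto_const_nhds.add ((Complex.continuous_ofReal.tendsto _).comp hε)
  have hLn : ∀ s : ℂ, 0 ≤ s.re → Tendsto
      (fun n : ℕ => laplaceTransform f (s + ((1 / ((n : ℝ) + 1) : ℝ) : ℂ))) atTop (𝓝 (Φ s)) := by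
    intro s hs
    refine ((hΦ s hs).tendsto.comp (hσ s)).congr fun n => (hL _ ?_).symm
    rw [Complex.add_re, Complex.ofReal_re]
    linarith [hεp n]
  have hlim : Tendsto (fun n : ℕ => ∫ x in Ioi 0, Real.exp (-(1 / ((n : ℝ) + 1)) * x) * f x) atTop
      (𝓝 1) := by
    have h := hLn 0 le_rfl
    simp_rw [zero_add, laplaceTransform_ofReal] at h
    rw [hΦ0] at h
    have := (Complex.continuous_re.tendsto _).comp h
    simpa [Function.comp_def] using this
  -- Fatou: the damped functions converge pointwise to f and their L¹ norms tend to Φ 0 = 1.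
  have hfi : IntegrableOn f (Ioi 0) := by
    refine integrable_of_tendsto (G := fun n x => Real.exp (-(1 / ((n : ℝ) + 1)) * x) * f x)
      (ae_of_all _ fun x => ?_) (fun n => (hI _ (hεp n)).aestronglyMeasurable) ?_
    · have := ((Real.continuous_exp.tendsto _).comp (hε.neg.mul_const x)).mul_const (f x)
      simpa using this
    · have he : ∀ n : ℕ, ∫⁻ x in Ioi 0, ‖Real.exp (-(1 / ((n : ℝ) + 1)) * x) * f x‖ₑ =
          ENNReal.ofReal (∫ x in Ioi 0, Real.exp (-(1 / ((n : ℝ) + 1)) * x) * f x) := by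
        intro n
        rw [ofReal_integral_eq_lintegral_ofReal (hI _ (hεp n))
          (ae_of_all _ fun x => mul_nonneg (Real.exp_nonneg _) (hn x))]
        refine lintegral_congr fun x => ?_
        exact Real.enorm_of_nonneg (mul_nonneg (Real.exp_nonneg _) (hn x))
      simp_rw [he]
      rw [(ENNReal.tendsto_ofReal hlim).liminf_eq]
      simp
  have hlap : ∀ s : ℂ, 0 ≤ s.re → laplaceTransform f s = Φ s := fun s hs =>
    tendsto_nhds_unique (tendsto_laplaceTransform hfi (fun n => by
      rw [Complex.add_re, Complex.ofReal_re]; linarith [hεp n]) (hσ s)) (hLn s hs)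
  have hsupp : (Ioi (0 : ℝ)).indicator f = f := by
    rw [indicator_eq_self]
    intro x hx
    by_contra h
    exact hx (h0 x (not_lt.1 h))
  refine ⟨⟨h0, hn, ?_, ?_⟩, hlap⟩
  · rw [← hsupp, integrable_indicator_iff measurableSet_Ioi]; exact hfi
  · rw [← hsupp, integral_indicator measurableSet_Ioi]
    have h := hlap 0 le_rfl
    rw [hΦ0, ← Complex.ofReal_zero, laplaceTransform_ofReal] at h
    simpa using congrArg Complex.re h

theorem differentiableOn_laplaceTransform
    (hI : ∀ ε > 0, IntegrableOn (fun x => Real.exp (-ε * x) * f x) (Ioi 0)) :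
    DifferentiableOn ℂ (laplaceTransform f) {s | 0 < s.re} := by
  have hm : AEStronglyMeasurable f (volume.restrict (Ioi 0)) := by
    have h := (by fun_prop : Continuous fun x : ℝ => Real.exp x).aestronglyMeasurable.mul
      (hI 1 one_pos).aestronglyMeasurable
    refine h.congr (ae_of_all _ fun x => ?_)
    simp [← mul_assoc, ← Real.exp_add]
  have hmC := Complex.continuous_ofReal.comp_aestronglyMeasurable hm
  intro s hs
  have hs' : 0 < s.re := hs
  refine DifferentiableAt.differentiableWithinAt ?_
  -- For Re z > 2δ, one factor exp(-δx) absorbs the x produced by differentiation and another is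
  -- left for the dominating function.
  set δ := s.re / 3 with hδ
  have hδ0 : 0 < δ := by positivity
  refine (hasDerivAt_integral_of_dominated_loc_of_deriv_le
    (F := fun (z : ℂ) (x : ℝ) => Complex.exp (-z * x) * (f x : ℂ))
    (F' := fun (z : ℂ) (x : ℝ) => Complex.exp (-z * x) * -(x : ℂ) * (f x : ℂ))
    (s := {z : ℂ | 2 * δ < z.re}) (bound := fun x => 1 / δ * ‖Real.exp (-δ * x) * f x‖)
    ?_ ?_ ?_ ?_ ?_ ((hI δ hδ0).norm.const_mul _) ?_).2.differentiableAt
  · exact (isOpen_lt continuous_const Complex.continuous_re).mem_nhds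
      (by rw [mem_ofPred_eq]; linarith)
  · refine Eventually.of_forall fun z => ?_
    exact (by fun_prop : Continuous fun x : ℝ => Complex.exp (-z * x)).aestronglyMeasurable.mul hmC
  · refine (integrable_norm_iff ?_).1 ?_
    · exact (by fun_prop : Continuous fun x : ℝ =>
        Complex.exp (-s * x)).aestronglyMeasurable.mul hmC
    · refine (hI _ hs').norm.congr (ae_of_all _ fun x => ?_)
      simp only [norm_mul, norm_exp_neg_mul_ofReal, Complex.norm_real,
        Real.norm_of_nonneg (Real.exp_nonneg _)]
  · exact (by fun_prop : Continuous fun x : ℝ =>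
      Complex.exp (-s * x) * -(x : ℂ)).aestronglyMeasurable.mul hmC
  · filter_upwards [ae_restrict_mem measurableSet_Ioi] with x hx z hz
    have hx' : 0 < x := hx
    have hz' : 2 * δ < z.re := hz
    simp only [norm_mul, norm_exp_neg_mul_ofReal, Complex.norm_real, norm_neg,
      Real.norm_of_nonneg (Real.exp_nonneg _), Real.norm_of_nonneg hx'.le]
    rw [← mul_assoc]
    refine mul_le_mul_of_nonneg_right ?_ (norm_nonneg _)
    have h1 : δ * x ≤ Real.exp (δ * x) := by linarith [Real.add_one_le_exp (δ * x)]
    have h2 : Real.exp (-z.re * x) ≤ Real.exp (-δ * x) * Real.exp (-(δ * x)) := by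
      rw [← Real.exp_add]
      exact Real.exp_le_exp.2 (by nlinarith)
    calc Real.exp (-z.re * x) * x
        ≤ (Real.exp (-δ * x) * Real.exp (-(δ * x))) * (1 / δ * Real.exp (δ * x)) := by
          gcongr
          rw [div_mul_eq_mul_div, one_mul, le_div_iff₀ hδ0]; linarith
      _ = 1 / δ * Real.exp (-δ * x) := by
          rw [Real.exp_neg (δ * x)]
          field_simp
  · refine ae_of_all _ fun x z _ => ?_
    have h : HasDerivAt (fun z : ℂ => -z * (x : ℂ)) (-(x : ℂ)) z := by
      simpa using (hasDerivAt_id z).neg.mul_const (x : ℂ)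
    exact h.cexp.mul_const _

end

/-! ### Laplace transform of the generalized Mittag-Leffler density -/

theorem integrableOn_rpow_mul_exp_neg_mul {a r : ℝ} (ha : 0 < a) (hr : 0 < r) :
    IntegrableOn (fun t : ℝ => t ^ (a - 1) * Real.exp (-(r * t))) (Ioi 0) := by
  -- A non-integrable function has integral 0 by convention, whereas this integral has a positive
  -- value.
  refine not_imp_comm.1 integral_undef ?_
  rw [Real.integral_rpow_mul_exp_neg_mul_Ioi ha hr]
  have := Real.Gamma_pos_of_pos ha
  positivity

theorem hasSum_pochCoeff_mul_pow_real (γ : ℝ) {x : ℝ} (hx : |x| < 1) :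
    HasSum (fun k => pochCoeff γ k * x ^ k) ((1 - x) ^ (-γ)) := by
  have h := hasSum_pochCoeff_mul_pow γ (z := (x : ℂ)) (by simpa using hx)
  have h1 : 0 ≤ 1 - x := by linarith [(abs_lt.1 hx).2]
  have e : 1 / (1 - (x : ℂ)) ^ (γ : ℂ) = (((1 - x) ^ (-γ) : ℝ) : ℂ) := by
    rw [Complex.ofReal_cpow h1, Complex.ofReal_neg, Complex.cpow_neg]; push_cast; rw [one_div]
  rw [e] at h
  exact_mod_cast h

section
variable {α c γ b s : ℝ}

/-- Termwise integration produces the binomial series at -c s^(-α); `hcs` places this inside the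
radius of convergence. -/
theorem integral_exp_mul_prabhakar (hα : 0 < α) (hc : 0 ≤ c) (hγ : 0 ≤ γ) (hb : 0 < b) (hs : 0 < s)
    (hcs : c * s ^ (-α) < 1) :
    ∫ x in Ioi 0, Real.exp (-s * x) * prabhakar α c γ b x =
      s ^ (-b) * (1 + c * s ^ (-α)) ^ (-γ) := by
  set q : ℝ := c * s ^ (-α) with hq
  have hq0 : 0 ≤ q := by positivity
  -- The parameter d is free because d = -c computes the integrals of the norms.
  have hint : ∀ (d : ℝ) (k : ℕ), ∫ x in Ioi 0, Real.exp (-s * x) * prabhakarTerm α d γ b k x =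
      s ^ (-b) * (pochCoeff γ k * (-(d * s ^ (-α))) ^ k) := by
    intro d k
    have hk : 0 < α * k + b := by positivity
    have hG := Real.Gamma_pos_of_pos hk
    have h := Real.integral_rpow_mul_exp_neg_mul_Ioi hk hs
    have e : ∀ x, Real.exp (-s * x) * prabhakarTerm α d γ b k x =
        pochCoeff γ k * (-d) ^ k / Real.Gamma (α * k + b) *
          (x ^ (α * k + b - 1) * Real.exp (-(s * x))) := by
      intro x; rw [prabhakarTerm, neg_mul]; ring
    simp_rw [e]
    rw [integral_const_mul, h, one_div, Real.inv_rpow hs.le, ← Real.rpow_neg hs.le, neg_add,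
      Real.rpow_add hs, ← neg_mul α, Real.rpow_mul hs.le, Real.rpow_natCast, ← neg_mul, mul_pow]
    field_simp
  have hsum := hasSum_integral_of_summable_integral_norm (μ := volume.restrict (Ioi 0))
    (F := fun k x => Real.exp (-s * x) * prabhakarTerm α c γ b k x) (fun k => by
      have h := (integrableOn_rpow_mul_exp_neg_mul (a := α * k + b) (by positivity) hs).const_mul
        (pochCoeff γ k * (-c) ^ k / Real.Gamma (α * k + b))
      refine h.congr (ae_of_all _ fun x => ?_)
      simp only [prabhakarTerm, neg_mul]; ring) (by
      have e : ∀ k : ℕ, ∫ x in Ioi 0, ‖Real.exp (-s * x) * prabhakarTerm α c γ b k x‖ =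
          s ^ (-b) * (pochCoeff γ k * q ^ k) := by
        intro k
        have h := hint (-c) k
        rw [neg_mul, neg_neg] at h
        rw [hq, ← h]
        refine setIntegral_congr_fun measurableSet_Ioi fun x hx => ?_
        have hx' : 0 < x := hx
        have hG := Real.Gamma_pos_of_pos (show 0 < α * k + b by positivity)
        simp only [prabhakarTerm, norm_mul, norm_div, norm_pow, norm_neg, neg_neg,
          Real.norm_of_nonneg (Real.exp_nonneg _), Real.norm_of_nonneg (pochCoeff_nonneg hγ k),
          Real.norm_of_nonneg hc, Real.norm_of_nonneg hG.le,
          Real.norm_of_nonneg (Real.rpow_nonneg hx'.le _)]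
      simp_rw [e]
      exact (summable_pochCoeff_mul_pow γ (by rwa [abs_of_nonneg hq0])).mul_left _)
  simp_rw [hint] at hsum
  have hr := (hasSum_pochCoeff_mul_pow_real γ (x := -q)
    (by rwa [abs_neg, abs_of_nonneg hq0])).mul_left (s ^ (-b))
  rw [sub_neg_eq_add] at hr
  rw [hr.unique hsum]
  refine setIntegral_congr_fun measurableSet_Ioi fun x hx => ?_
  rw [← tsum_prabhakarTerm hx, ← tsum_mul_left]

end

/-- The Laplace transform of the generalized Mittag-Leffler density. -/
noncomputable def mlLaplace (α γ : ℝ) (s : ℂ) : ℂ := (1 + s ^ (α : ℂ) / γ) ^ (-γ : ℂ)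

section
variable {α γ : ℝ}

/-- Raising to a power α < 1 shrinks the argument, so it stays in [-π/2, π/2]. -/
theorem re_cpow_nonneg (hα0 : 0 < α) (hα1 : α < 1) {s : ℂ} (hs : 0 ≤ s.re) :
    0 ≤ (s ^ (α : ℂ)).re := by
  rw [Complex.cpow_ofReal_re]
  refine mul_nonneg (by positivity) (Real.cos_nonneg_of_mem_Icc ?_)
  have h := Complex.abs_arg_le_pi_div_two_iff.2 hs
  rw [mem_Icc, ← abs_le, abs_mul, abs_of_pos hα0]
  nlinarith [abs_nonneg s.arg]

theorem one_add_cpow_div_mem_slitPlane (hα0 : 0 < α) (hα1 : α < 1) (hγ : 0 < γ) {s : ℂ}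
    (hs : 0 ≤ s.re) : 1 + s ^ (α : ℂ) / γ ∈ Complex.slitPlane := by
  refine Or.inl ?_
  rw [Complex.add_re, Complex.one_re, Complex.div_ofReal_re]
  have := re_cpow_nonneg hα0 hα1 hs
  positivity

theorem continuousAt_mlLaplace (hα0 : 0 < α) (hα1 : α < 1) (hγ : 0 < γ) {s : ℂ} (hs : 0 ≤ s.re) :
    ContinuousAt (mlLaplace α γ) s :=
  (continuousAt_const.add ((Complex.continuousAt_cpow_const_of_re_pos (Or.inl hs)
    (by simpa using hα0)).div_const _)).cpow continuousAt_const
    (one_add_cpow_div_mem_slitPlane hα0 hα1 hγ hs)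

theorem differentiableOn_mlLaplace (hα0 : 0 < α) (hα1 : α < 1) (hγ : 0 < γ) :
    DifferentiableOn ℂ (mlLaplace α γ) {s | 0 < s.re} := fun _ hs =>
  (((((differentiableAt_id).cpow_const (Or.inl hs)).div_const _).const_add 1).cpow_const
    (one_add_cpow_div_mem_slitPlane hα0 hα1 hγ (le_of_lt hs))).differentiableWithinAt

theorem mlLaplace_zero (hα0 : 0 < α) : mlLaplace α γ 0 = 1 := by
  rw [mlLaplace, Complex.zero_cpow (by exact_mod_cast hα0.ne')]; simp

theorem mlLaplace_ofReal (hγ : 0 < γ) {t : ℝ} (ht : 0 ≤ t) :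
    mlLaplace α γ t = (((1 + t ^ α / γ) ^ (-γ) : ℝ) : ℂ) := by
  rw [mlLaplace, Complex.ofReal_cpow (by positivity)]
  push_cast
  rw [Complex.ofReal_cpow ht]

theorem integrableOn_exp_mul_mlDensity (hα0 : 0 < α) (hα1 : α < 1) (hγ : 0 < γ) {ε : ℝ}
    (hε : 0 < ε) : IntegrableOn (fun x => Real.exp (-ε * x) * mlDensity α γ x) (Ioi 0) := by
  refine ((integrableOn_rpow_mul_exp_neg_mul (mul_pos hα0 hγ) hε).const_mul
    (γ ^ γ / Real.Gamma (α * γ))).mono' ?_ ?_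
  · exact (by fun_prop : Continuous fun x : ℝ => Real.exp (-ε * x)).aestronglyMeasurable.mul
      ((continuousOn_mlDensity hα0 hγ).aestronglyMeasurable measurableSet_Ioi)
  · filter_upwards [ae_restrict_mem measurableSet_Ioi] with x hx
    rw [Real.norm_of_nonneg (mul_nonneg (Real.exp_nonneg _) (mlDensity_nonneg hα0 hα1 hγ x)),
      neg_mul, mul_comm, ← mul_assoc]
    exact mul_le_mul_of_nonneg_right (mlDensity_le hα0 hα1 hγ hx) (Real.exp_nonneg _)

theorem laplaceTransform_mlDensity_ofReal (hα : 0 < α) (hγ : 0 < γ) {s : ℝ} (hs : 0 < s)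
    (hγs : γ < s ^ α) : laplaceTransform (mlDensity α γ) s = mlLaplace α γ s := by
  have hsα : 0 < s ^ α := by positivity
  rw [laplaceTransform_ofReal, mlLaplace_ofReal hγ hs.le]
  congr 1
  have h : ∫ x in Ioi 0, Real.exp (-s * x) * mlDensity α γ x =
      γ ^ γ * ∫ x in Ioi 0, Real.exp (-s * x) * prabhakar α γ γ (α * γ) x := by
    rw [← integral_const_mul]
    refine setIntegral_congr_fun measurableSet_Ioi fun x hx => ?_
    rw [mlDensity_of_pos hx]; ring
  rw [h, integral_exp_mul_prabhakar hα hγ.le hγ.le (mul_pos hα hγ) hs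
    (by rw [Real.rpow_neg hs.le, ← div_eq_mul_inv, div_lt_one hsα]; exact hγs)]
  have e1 : γ ^ γ = γ⁻¹ ^ (-γ) := by rw [Real.inv_rpow hγ.le, Real.rpow_neg hγ.le, inv_inv]
  have e2 : s ^ (-(α * γ)) = (s ^ α) ^ (-γ) := by rw [← Real.rpow_mul hs.le]; ring_nf
  rw [e1, e2, ← Real.mul_rpow (by positivity) (by positivity),
    ← Real.mul_rpow (by positivity) (by positivity), Real.rpow_neg hs.le]
  congr 1
  field_simp
  ring

/-- Both sides are analytic on the half-plane and agree at real points accumulating at s₀, where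
s₀^α = γ + 1 lies in the range of termwise integration. -/
theorem laplaceTransform_mlDensity_of_re_pos (hα0 : 0 < α) (hα1 : α < 1) (hγ : 0 < γ) {s : ℂ}
    (hs : 0 < s.re) : laplaceTransform (mlDensity α γ) s = mlLaplace α γ s := by
  have hopen : IsOpen {s : ℂ | 0 < s.re} := isOpen_lt continuous_const Complex.continuous_re
  have hpre : IsPreconnected {s : ℂ | 0 < s.re} := (convex_halfSpace_re_gt 0).isPreconnected
  set s₀ : ℝ := (γ + 1) ^ (1 / α) with hs₀
  have hs₀0 : 0 < s₀ := by positivity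
  have hs₀α : ∀ t : ℝ, 0 < t → γ < (s₀ + t) ^ α := by
    intro t ht
    have h1 : s₀ ^ α = γ + 1 := by
      rw [hs₀, ← Real.rpow_mul (by positivity), one_div_mul_cancel hα0.ne', Real.rpow_one]
    have h2 : s₀ ^ α ≤ (s₀ + t) ^ α := Real.rpow_le_rpow hs₀0.le (by linarith) hα0.le
    linarith
  have hL := (differentiableOn_laplaceTransform fun ε hε =>
    integrableOn_exp_mul_mlDensity hα0 hα1 hγ hε).analyticOnNhd hopen
  have hR := (differentiableOn_mlLaplace hα0 hα1 hγ).analyticOnNhd hopen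
  refine hL.eqOn_of_preconnected_of_frequently_eq hR hpre (z₀ := (s₀ : ℂ))
    (by simpa using hs₀0) ?_ hs
  have hlim : Tendsto (fun n : ℕ => ((s₀ + 1 / ((n : ℝ) + 1) : ℝ) : ℂ)) atTop (𝓝[≠] (s₀ : ℂ)) := by
    refine tendsto_nhdsWithin_iff.2 ⟨?_, Eventually.of_forall fun n => ?_⟩
    · refine (Complex.continuous_ofReal.tendsto _).comp ?_
      simpa using tendsto_const_nhds.add (tendsto_one_div_add_atTop_nhds_zero_nat (𝕜 := ℝ))
    · have : (0 : ℝ) < 1 / ((n : ℝ) + 1) := by positivity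
      rw [mem_compl_iff, mem_singleton_iff, Complex.ofReal_inj]
      linarith
  refine hlim.frequently (Frequently.of_forall fun n => ?_)
  have : (0 : ℝ) < 1 / ((n : ℝ) + 1) := by positivity
  exact laplaceTransform_mlDensity_ofReal hα0 hγ (by positivity) (hs₀α _ this)

theorem isPositiveDensity_mlDensity_and_laplace (hα0 : 0 < α) (hα1 : α < 1) (hγ : 0 < γ) :
    IsPositiveDensity (mlDensity α γ) ∧
      ∀ s : ℂ, 0 ≤ s.re → laplaceTransform (mlDensity α γ) s = mlLaplace α γ s :=
  isPositiveDensity_and_laplace (fun _ hx => mlDensity_of_nonpos hx)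
    (mlDensity_nonneg hα0 hα1 hγ)
    (fun _ hε => integrableOn_exp_mul_mlDensity hα0 hα1 hγ hε)
    (fun _ hs => continuousAt_mlLaplace hα0 hα1 hγ hs) (mlLaplace_zero hα0)
    (fun _ hs => laplaceTransform_mlDensity_of_re_pos hα0 hα1 hγ hs)

end

/-! ### From Laplace transforms to Mellin inversion -/

/-- Integrating the Laplace transform of `f` against `t^(w-1)` gives the Mellin transform of `f`. -/
theorem mellin_of_laplace {f Φ : ℝ → ℝ} (hf : ∀ x > 0, 0 ≤ f x) (hfi : IntegrableOn f (Ioi 0))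
    (hL : ∀ t > 0, ∫ x in Ioi 0, Real.exp (-t * x) * f x = Φ t) {w : ℂ} (hw : 0 < w.re)
    (hM : MellinConvergent (fun t => (Φ t : ℂ)) w) :
    MellinConvergent (fun x => (f x : ℂ)) (1 - w) ∧
      Complex.Gamma w * mellin (fun x => (f x : ℂ)) (1 - w) = mellin (fun t => (Φ t : ℂ)) w := by
  have hΓ := Complex.Gamma_ne_zero_of_re_pos hw
  set μ : Measure ℝ := volume.restrict (Ioi 0) with hμ
  set H : ℝ → ℝ → ℂ := fun t x => (t : ℂ) ^ (w - 1) * (Complex.exp (-(x * t)) * (f x : ℂ)) with hH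
  have hpos : ∀ᵐ x ∂μ, x ∈ Ioi (0 : ℝ) := ae_restrict_mem measurableSet_Ioi
  have hnorm : ∀ t ∈ Ioi (0 : ℝ), ∀ x ∈ Ioi (0 : ℝ),
      ‖H t x‖ = t ^ (w.re - 1) * (Real.exp (-t * x) * f x) := by
    intro t ht x hx
    simp only [hH, norm_mul, Complex.norm_real, Real.norm_of_nonneg (hf x hx)]
    rw [Complex.norm_cpow_eq_rpow_re_of_pos ht, Complex.norm_exp]
    simp [mul_comm]
  have hexp : ∀ t ∈ Ioi (0 : ℝ), Integrable (fun x => Real.exp (-t * x) * f x) μ := by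
    intro t ht
    refine Integrable.mono hfi ((by fun_prop : Continuous fun x : ℝ =>
      Real.exp (-t * x)).aestronglyMeasurable.mul hfi.aestronglyMeasurable) ?_
    filter_upwards [hpos] with x hx
    rw [norm_mul, Real.norm_of_nonneg (Real.exp_nonneg _)]
    refine mul_le_of_le_one_left (norm_nonneg _) (Real.exp_le_one_iff.2 ?_)
    have : 0 < t * x := mul_pos ht hx
    linarith
  have hmeas : AEStronglyMeasurable (Function.uncurry H) (μ.prod μ) := by
    have h1 : Measurable fun p : ℝ × ℝ => (p.1 : ℂ) ^ (w - 1) := by fun_prop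
    have h2 : Continuous fun p : ℝ × ℝ => Complex.exp (-((p.2 : ℂ) * p.1)) := by fun_prop
    exact h1.aestronglyMeasurable.mul (h2.aestronglyMeasurable.mul
      (Complex.continuous_ofReal.comp_aestronglyMeasurable hfi.aestronglyMeasurable).comp_snd)
  -- Since f ≥ 0, the inner integral of the norm is t^(Re w - 1) Φ(t), so `hM` is exactly the
  -- integrability needed for Fubini.
  have hint : Integrable (Function.uncurry H) (μ.prod μ) := by
    refine (integrable_prod_iff hmeas).2 ⟨?_, ?_⟩
    · filter_upwards [hpos] with t ht
      change Integrable (fun x => H t x) μ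
      refine Integrable.const_mul ?_ _
      refine (hexp t ht).ofReal.congr (ae_of_all _ fun x => ?_)
      simp [mul_comm]
    · have hM' : Integrable (fun t : ℝ => ‖(t : ℂ) ^ (w - 1) • (Φ t : ℂ)‖) μ := hM.norm
      refine hM'.congr ?_
      filter_upwards [hpos] with t ht
      have h3 : ∫ x, ‖Function.uncurry H (t, x)‖ ∂μ = t ^ (w.re - 1) * Φ t := by
        rw [← hL t ht, ← integral_const_mul]
        exact setIntegral_congr_fun measurableSet_Ioi fun x hx => hnorm t ht x hx
      have hΦ : 0 ≤ Φ t := by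
        rw [← hL t ht]
        exact setIntegral_nonneg measurableSet_Ioi fun x hx =>
          mul_nonneg (Real.exp_nonneg _) (hf x hx)
      rw [h3, norm_smul, Complex.norm_cpow_eq_rpow_re_of_pos ht, Complex.norm_real,
        Real.norm_of_nonneg hΦ]
      simp
  have hin : ∀ x ∈ Ioi (0 : ℝ), ∫ t, H t x ∂μ =
      Complex.Gamma w * ((x : ℂ) ^ ((1 - w) - 1) • (f x : ℂ)) := by
    intro x hx
    simp only [hH, ← mul_assoc]
    rw [integral_mul_const, hμ, Complex.integral_cpow_mul_exp_neg_mul_Ioi hw hx, one_div,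
      Complex.inv_cpow _ _ (by rw [Complex.arg_ofReal_of_nonneg (le_of_lt hx)]; exact Real.pi_pos.ne),
      ← Complex.cpow_neg, show (1 - w) - 1 = -w by ring, smul_eq_mul]
    ring
  have hin' : ∀ᵐ x ∂μ, ∫ t, H t x ∂μ =
      Complex.Gamma w * ((x : ℂ) ^ ((1 - w) - 1) • (f x : ℂ)) := by
    filter_upwards [hpos] with x hx using hin x hx
  constructor
  · have h4 := (hint.integral_prod_right.congr hin').const_mul (Complex.Gamma w)⁻¹
    refine h4.congr (ae_of_all _ fun x => ?_)
    simp only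
    rw [← mul_assoc, inv_mul_cancel₀ hΓ, one_mul]
  · have h5 := integral_integral_swap hint
    rw [integral_congr_ae hin', integral_const_mul] at h5
    rw [mellin, mellin, ← h5]
    refine setIntegral_congr_fun measurableSet_Ioi fun t ht => ?_
    simp only [hH]
    rw [integral_const_mul, smul_eq_mul, ← hL t ht, ← integral_complex_ofReal]
    congr 2 with x
    push_cast
    rw [neg_mul, mul_comm (x : ℂ)]

theorem mellinConvergent_one_add_rpow {γ : ℝ} {w : ℂ} (hw : 0 < w.re) (hwγ : w.re < γ) :
    MellinConvergent (fun t : ℝ => (((1 + t) ^ (-γ) : ℝ) : ℂ)) w := by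
  have hγ : 0 < γ := hw.trans hwγ
  have hcont : ContinuousOn (fun t : ℝ => (((1 + t) ^ (-γ) : ℝ) : ℂ)) (Ioi 0) := by
    refine Complex.continuous_ofReal.comp_continuousOn
      (ContinuousOn.rpow_const (by fun_prop) fun t ht => Or.inl ?_)
    have : (0 : ℝ) < t := ht
    positivity
  refine mellinConvergent_of_isBigO_rpow (a := γ) (b := 0)
    (hcont.locallyIntegrableOn measurableSet_Ioi) ?_ hwγ ?_ hw
  · refine Asymptotics.IsBigO.of_bound 1 ?_
    filter_upwards [eventually_gt_atTop 0] with t ht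
    rw [Complex.norm_real, one_mul, Real.norm_of_nonneg (by positivity),
      Real.norm_of_nonneg (by positivity)]
    exact Real.rpow_le_rpow_of_nonpos ht (by linarith) (by linarith)
  · refine Asymptotics.IsBigO.of_bound 1 ?_
    filter_upwards [self_mem_nhdsWithin] with t ht
    have ht' : (0 : ℝ) < t := ht
    rw [Complex.norm_real, one_mul, Real.norm_of_nonneg (by positivity)]
    simp only [neg_zero, Real.rpow_zero, norm_one]
    exact Real.rpow_le_one_of_one_le_of_nonpos (by linarith) (by linarith)

/-- (1 + t)^(-γ) is the Laplace transform of the Gamma density x^(γ-1) e^(-x) / Γ(γ), whose Mellin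
transform at 1 - w is Γ(γ - w) / Γ(γ). -/
theorem mellin_one_add_rpow {γ : ℝ} {w : ℂ} (hw : 0 < w.re) (hwγ : w.re < γ) :
    mellin (fun t : ℝ => (((1 + t) ^ (-γ) : ℝ) : ℂ)) w =
      Complex.Gamma w * Complex.Gamma (γ - w) / Complex.Gamma γ := by
  have hγ : 0 < γ := hw.trans hwγ
  have hΓ := Real.Gamma_pos_of_pos hγ
  have h := (mellin_of_laplace (f := fun x => (Real.Gamma γ)⁻¹ * (x ^ (γ - 1) * Real.exp (-(1 * x))))
    (Φ := fun t => (1 + t) ^ (-γ)) (fun x hx => by positivity)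
    ((integrableOn_rpow_mul_exp_neg_mul hγ one_pos).const_mul _) (fun t ht => ?_) hw
    (mellinConvergent_one_add_rpow hw hwγ)).2
  · rw [← h, mul_div_assoc]
    congr 1
    have hre : 0 < ((γ : ℂ) - w).re := by simpa using hwγ
    rw [Complex.Gamma_eq_integral hre, Complex.GammaIntegral, mellin, div_eq_inv_mul,
      Complex.Gamma_ofReal, ← integral_const_mul]
    refine setIntegral_congr_fun measurableSet_Ioi fun x hx => ?_
    have hx0 : (x : ℂ) ≠ 0 := Complex.ofReal_ne_zero.2 (ne_of_gt hx)
    simp only [smul_eq_mul, one_mul]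
    push_cast
    rw [Complex.ofReal_cpow (le_of_lt hx), show (γ : ℂ) - w - 1 = (1 - w - 1) + (γ - 1) by ring,
      Complex.cpow_add _ _ hx0]
    push_cast
    ring
  · have h1 : 0 < 1 + t := by positivity
    have h2 := Real.integral_rpow_mul_exp_neg_mul_Ioi hγ h1
    have e : ∀ x, Real.exp (-t * x) * ((Real.Gamma γ)⁻¹ * (x ^ (γ - 1) * Real.exp (-(1 * x)))) =
        (Real.Gamma γ)⁻¹ * (x ^ (γ - 1) * Real.exp (-((1 + t) * x))) := by
      intro x
      rw [show -((1 + t) * x) = -t * x + -(1 * x) by ring, Real.exp_add]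
      ring
    simp_rw [e]
    rw [integral_const_mul, h2, one_div, Real.inv_rpow h1.le, Real.rpow_neg h1.le]
    field_simp

theorem mellin_one_add_div_rpow {γ : ℝ} {w : ℂ} (hw : 0 < w.re) (hwγ : w.re < γ) :
    HasMellin (fun t : ℝ => (((1 + t / γ) ^ (-γ) : ℝ) : ℂ)) w
      (γ ^ w * (Complex.Gamma w * Complex.Gamma (γ - w) / Complex.Gamma γ)) := by
  have hγ : 0 < γ := hw.trans hwγ
  have h1 := mellinConvergent_one_add_rpow hw hwγ
  have h2 := mellin_one_add_rpow hw hwγ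
  refine ⟨?_, ?_⟩
  · simpa only [div_eq_inv_mul] using (MellinConvergent.comp_mul_left (inv_pos.2 hγ)).2 h1
  · have h3 := mellin_comp_mul_left (fun t : ℝ => (((1 + t) ^ (-γ) : ℝ) : ℂ)) w (inv_pos.2 hγ)
    simp only [← div_eq_inv_mul] at h3
    rw [h3, h2, Complex.ofReal_inv, Complex.inv_cpow _ _
      (by rw [Complex.arg_ofReal_of_nonneg hγ.le]; exact Real.pi_pos.ne), Complex.cpow_neg, inv_inv,
      smul_eq_mul]

theorem HasMellin.comp_rpow {g : ℝ → ℂ} {α : ℝ} (hα : 0 < α) {w m : ℂ}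
    (h : HasMellin g (w / α) m) : HasMellin (fun t : ℝ => g (t ^ α)) w (m / α) := by
  refine ⟨(MellinConvergent.comp_rpow hα.ne').2 h.1, ?_⟩
  rw [mellin_comp_rpow, h.2, abs_of_pos hα, Complex.real_smul, Complex.ofReal_inv, div_eq_inv_mul]

theorem hasMellin_exp_neg {w : ℂ} (hw : 0 < w.re) :
    HasMellin (fun t : ℝ => ((Real.exp (-t) : ℝ) : ℂ)) w (Complex.Gamma w) := by
  refine ⟨?_, ?_⟩
  · refine (Complex.GammaIntegral_convergent hw).congr (ae_of_all _ fun t => ?_)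
    simp only [smul_eq_mul, mul_comm]
  · rw [Complex.Gamma_eq_integral hw, Complex.GammaIntegral_eq_mellin]

/-- A density that is continuous on the positive half-line is recovered from its Laplace transform
by Mellin inversion. -/
theorem hasMellinBarnes_of_laplace {f Φ : ℝ → ℝ} (hf : IsPositiveDensity f)
    (hfc : ContinuousOn f (Ioi 0)) (hL : ∀ t : ℝ, 0 < t → laplaceTransform f t = Φ t)
    {K : ℂ → ℂ} {c : ℝ} (hc : c < 1)
    (hM : ∀ s : ℂ, s.re = c → HasMellin (fun t => (Φ t : ℂ)) (1 - s) (Complex.Gamma (1 - s) * K s))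
    (hK : Complex.VerticalIntegrable K c) : HasMellinBarnes f K c := by
  refine ⟨hK, fun x hx => ?_⟩
  have hfi : IntegrableOn f (Ioi 0) := hf.integrable.integrableOn
  have hL' : ∀ t > 0, ∫ x in Ioi 0, Real.exp (-t * x) * f x = Φ t := by
    intro t ht
    have h := hL t ht
    rw [laplaceTransform_ofReal] at h
    exact_mod_cast h
  have hmel : ∀ s : ℂ, s.re = c → HasMellin (fun x => (f x : ℂ)) s (K s) := by
    intro s hs
    have hre : 0 < (1 - s).re := by rw [Complex.sub_re, Complex.one_re, hs]; linarith
    obtain ⟨h1, h2⟩ := mellin_of_laplace (fun x _ => hf.nonneg x) hfi hL' hre (hM s hs).1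
    rw [sub_sub_cancel] at h1 h2
    exact ⟨h1, mul_left_cancel₀ (Complex.Gamma_ne_zero_of_re_pos hre) (h2.trans (hM s hs).2)⟩
  have hline : ∀ y : ℝ, mellin (fun x => (f x : ℂ)) (c + y * Complex.I) = K (c + y * Complex.I) :=
    fun y => (hmel _ (by simp)).2
  have hinv := mellinInv_mellin_eq c (fun x => (f x : ℂ)) hx (hmel c (by simp)).1
    (by unfold Complex.VerticalIntegrable; simp_rw [hline]; exact hK)
    (Complex.continuous_ofReal.continuousAt.comp (hfc.continuousAt (Ioi_mem_nhds hx)))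
  rw [← hinv]
  unfold mellinInv
  simp_rw [hline]

/-! ### Growth of the Gamma function on vertical lines -/

theorem norm_Gamma_le {s : ℂ} (hs : 0 < s.re) : ‖Complex.Gamma s‖ ≤ Real.Gamma s.re := by
  rw [Complex.Gamma_eq_integral hs, Complex.GammaIntegral, Real.Gamma_eq_integral hs]
  refine (norm_integral_le_integral_norm _).trans_eq ?_
  refine setIntegral_congr_fun measurableSet_Ioi fun x hx => ?_
  simp only [norm_mul, Complex.norm_real, Real.norm_of_nonneg (Real.exp_nonneg _)]
  rw [Complex.norm_cpow_eq_rpow_re_of_pos hx, Complex.sub_re, Complex.one_re]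

/-- `‖Γ(a + iy)‖ / Γ(a)` is increasing in `a`. -/
theorem norm_Gamma_mul_Gamma_le {s : ℂ} {b : ℝ} (hs : 0 < s.re) (hb : 0 < b) :
    ‖Complex.Gamma s‖ * Real.Gamma (s.re + b) ≤ ‖Complex.Gamma (s + b)‖ * Real.Gamma s.re := by
  have hΓb := Real.Gamma_pos_of_pos hb
  have hΓsb := Real.Gamma_pos_of_pos (add_pos hs hb)
  have h1 := Complex.Gamma_mul_Gamma_eq_betaIntegral hs (t := b) (by simpa using hb)
  -- The Beta integral is bounded by its value at Re s; the claim follows from B(s, b) =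
  -- Γ(s)Γ(b)/Γ(s + b).
  have h2 : ‖Complex.betaIntegral s b‖ ≤
      Real.Gamma b * Real.Gamma s.re / Real.Gamma (s.re + b) := by
    have h3 := integral_sub_rpow_mul_rpow hb hs one_pos
    rw [Real.one_rpow, one_mul, add_comm b] at h3
    rw [← h3, Complex.betaIntegral]
    refine (intervalIntegral.norm_integral_le_integral_norm zero_le_one).trans_eq ?_
    simp_rw [intervalIntegral.integral_of_le zero_le_one, integral_Ioc_eq_integral_Ioo]
    refine setIntegral_congr_fun measurableSet_Ioo fun x hx => ?_
    simp only [norm_mul]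
    rw [Complex.norm_cpow_eq_rpow_re_of_pos hx.1, ← Complex.ofReal_one, ← Complex.ofReal_sub,
      Complex.norm_cpow_eq_rpow_re_of_pos (sub_pos.2 hx.2), mul_comm]
    simp
  have h4 := congrArg norm h1
  rw [norm_mul, norm_mul, Complex.Gamma_ofReal, Complex.norm_real, Real.norm_of_nonneg hΓb.le] at h4
  rw [le_div_iff₀ hΓsb] at h2
  refine le_of_mul_le_mul_right ?_ hΓb
  calc _ = ‖Complex.Gamma (s + b)‖ * (‖Complex.betaIntegral s b‖ * Real.Gamma (s.re + b)) := by
        rw [← mul_assoc, ← h4]; ring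
    _ ≤ ‖Complex.Gamma (s + b)‖ * (Real.Gamma b * Real.Gamma s.re) := by gcongr
    _ = _ := by ring

/-- On Re s = 1/2, 1 - s is the conjugate of s, so the reflection formula computes the modulus
exactly. -/
theorem norm_Gamma_half_sq (y : ℝ) :
    ‖Complex.Gamma (1 / 2 + y * Complex.I)‖ ^ 2 = Real.pi / Real.cosh (Real.pi * y) := by
  have h1 := Complex.Gamma_mul_Gamma_one_sub (1 / 2 + y * Complex.I)
  have h2 : (1 : ℂ) - (1 / 2 + y * Complex.I) =
      (starRingEnd ℂ) (1 / 2 + y * Complex.I) := by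
    simp [Complex.ext_iff]; norm_num
  have h3 : Complex.sin (Real.pi * (1 / 2 + y * Complex.I)) =
      (Real.cosh (Real.pi * y) : ℂ) := by
    rw [show (Real.pi : ℂ) * (1 / 2 + y * Complex.I) =
      ((Real.pi * y : ℝ) : ℂ) * Complex.I + Real.pi / 2 by push_cast; ring,
      Complex.sin_add_pi_div_two, Complex.cos_mul_I, Complex.ofReal_cosh]
  rw [h2, Complex.Gamma_conj, Complex.mul_conj, h3, Complex.normSq_eq_norm_sq] at h1
  exact_mod_cast h1

theorem norm_Gamma_half_le (y : ℝ) : ‖Complex.Gamma (1 / 2 + y * Complex.I)‖ ≤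
    √(2 * Real.pi) * Real.exp (-(Real.pi / 2 * |y|)) := by
  refine le_of_sq_le_sq ?_ (by positivity)
  rw [norm_Gamma_half_sq, mul_pow, Real.sq_sqrt (by positivity), ← Real.exp_nat_mul,
    ← Real.cosh_abs, abs_mul, abs_of_pos Real.pi_pos, Real.cosh_eq, div_le_iff₀ (by positivity)]
  have e : Real.exp ((2 : ℕ) * -(Real.pi / 2 * |y|)) * Real.exp (Real.pi * |y|) = 1 := by
    rw [← Real.exp_add, ← Real.exp_zero]; congr 1; push_cast; ring
  have : 0 ≤ Real.exp ((2 : ℕ) * -(Real.pi / 2 * |y|)) * Real.exp (-(Real.pi * |y|)) := by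
    positivity
  nlinarith [Real.pi_pos]

theorem le_norm_Gamma_half (y : ℝ) :
    Real.exp (-(Real.pi / 2 * |y|)) ≤ ‖Complex.Gamma (1 / 2 + y * Complex.I)‖ := by
  refine le_of_sq_le_sq ?_ (norm_nonneg _)
  rw [norm_Gamma_half_sq, ← Real.exp_nat_mul,
    ← Real.cosh_abs, abs_mul, abs_of_pos Real.pi_pos, Real.cosh_eq, le_div_iff₀ (by positivity)]
  have e : Real.exp ((2 : ℕ) * -(Real.pi / 2 * |y|)) * Real.exp (Real.pi * |y|) = 1 := by
    rw [← Real.exp_add, ← Real.exp_zero]; congr 1; push_cast; ring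
  have : Real.exp ((2 : ℕ) * -(Real.pi / 2 * |y|)) * Real.exp (-(Real.pi * |y|)) ≤ 1 := by
    rw [← Real.exp_add, Real.exp_le_one_iff]; push_cast
    have : 0 ≤ Real.pi * |y| := by positivity
    linarith
  nlinarith [Real.pi_gt_three]

theorem norm_add_mul_I_le {a : ℝ} (ha : 0 ≤ a) (y : ℝ) :
    ‖(a + y * Complex.I : ℂ)‖ ≤ (a + 1) * (1 + |y|) := by
  refine (norm_add_le _ _).trans ?_
  rw [norm_mul, Complex.norm_I, Complex.norm_real, Complex.norm_real, Real.norm_of_nonneg ha,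
    Real.norm_eq_abs]
  nlinarith [abs_nonneg y]

theorem norm_Gamma_nat_add_half_le (n : ℕ) : ∃ C > 0, ∀ y : ℝ,
    ‖Complex.Gamma (((n + 1 / 2 : ℝ) : ℂ) + y * Complex.I)‖ ≤
      C * (1 + |y|) ^ n * Real.exp (-(Real.pi / 2 * |y|)) := by
  induction n with
  | zero =>
    refine ⟨√(2 * Real.pi), by positivity, fun y => ?_⟩
    have := norm_Gamma_half_le y
    simpa using this
  | succ n ih =>
    obtain ⟨C, hC, h⟩ := ih
    refine ⟨C * (n + 1 / 2 + 1), by positivity, fun y => ?_⟩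
    have hne : (((n + 1 / 2 : ℝ) : ℂ) + y * Complex.I) ≠ 0 := by
      intro h0
      have := congrArg Complex.re h0
      simp at this
      have hn : (0 : ℝ) ≤ n := n.cast_nonneg
      linarith
    have e : (((n + 1 : ℕ) + 1 / 2 : ℝ) : ℂ) + y * Complex.I =
        (((n + 1 / 2 : ℝ) : ℂ) + y * Complex.I) + 1 := by push_cast; ring
    rw [e, Complex.Gamma_add_one _ hne, norm_mul]
    calc _ ≤ ((n + 1 / 2 + 1) * (1 + |y|)) *
          (C * (1 + |y|) ^ n * Real.exp (-(Real.pi / 2 * |y|))) := by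
          gcongr
          · exact norm_add_mul_I_le (by positivity) y
          · exact h y
      _ = _ := by ring

/-- By `norm_Gamma_mul_Gamma_le`, Γ on Re s = a is controlled by Γ on a half-integer line further
right, where the functional equation reduces to Re s = 1/2. -/
theorem exists_norm_Gamma_le {a : ℝ} (ha : 0 < a) : ∃ C > 0, ∃ n : ℕ, ∀ y : ℝ,
    ‖Complex.Gamma (a + y * Complex.I)‖ ≤
      C * (1 + |y|) ^ n * Real.exp (-(Real.pi / 2 * |y|)) := by
  obtain ⟨n, hn⟩ := exists_nat_gt a
  obtain ⟨C, hC, h⟩ := norm_Gamma_nat_add_half_le n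
  have hb : 0 < n + 1 / 2 - a := by linarith
  have hΓ := Real.Gamma_pos_of_pos ha
  have hΓ' := Real.Gamma_pos_of_pos (show (0 : ℝ) < n + 1 / 2 by positivity)
  refine ⟨C * Real.Gamma a / Real.Gamma (n + 1 / 2), by positivity, n, fun y => ?_⟩
  have h1 := norm_Gamma_mul_Gamma_le (s := a + y * Complex.I) (by simpa using ha) hb
  have hre : (a + y * Complex.I : ℂ).re = a := by simp
  have e : (a + y * Complex.I : ℂ) + ((n + 1 / 2 - a : ℝ) : ℂ) =
      ((n + 1 / 2 : ℝ) : ℂ) + y * Complex.I := by push_cast; ring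
  rw [hre, e, add_sub_cancel] at h1
  rw [← le_div_iff₀ hΓ'] at h1
  refine h1.trans ?_
  calc _ ≤ (C * (1 + |y|) ^ n * Real.exp (-(Real.pi / 2 * |y|))) * Real.Gamma a /
        Real.Gamma (n + 1 / 2) := by gcongr; exact h y
    _ = _ := by ring

/-- The line Re s = 1/2 bounds the line a + 1 from below; returning to a divides by |s|, hence the
factor 1 + |y|. -/
theorem exists_le_norm_Gamma {a : ℝ} (ha : 0 < a) : ∃ C > 0, ∀ y : ℝ,
    C * Real.exp (-(Real.pi / 2 * |y|)) ≤
      (1 + |y|) * ‖Complex.Gamma (a + y * Complex.I)‖ := by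
  have hΓ := Real.Gamma_pos_of_pos (show 0 < a + 1 by positivity)
  have hΓ' := Real.Gamma_pos_of_pos (show (0 : ℝ) < 1 / 2 by positivity)
  refine ⟨Real.Gamma (a + 1) / Real.Gamma (1 / 2) / (a + 1), by positivity, fun y => ?_⟩
  have h1 := norm_Gamma_mul_Gamma_le (s := 1 / 2 + y * Complex.I) (b := a + 1 / 2) (by simp)
    (by positivity)
  have hre : (1 / 2 + y * Complex.I : ℂ).re = 1 / 2 := by simp
  have hne : (a + y * Complex.I : ℂ) ≠ 0 := by
    intro h0
    have := congrArg Complex.re h0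
    simp at this
    linarith
  have e : (1 / 2 + y * Complex.I : ℂ) + ((a + 1 / 2 : ℝ) : ℂ) = (a + y * Complex.I) + 1 := by
    push_cast; ring
  rw [hre, e, Complex.Gamma_add_one _ hne, norm_mul,
    show (1 / 2 + (a + 1 / 2) : ℝ) = a + 1 by ring] at h1
  have h2 := le_norm_Gamma_half y
  have h3 := norm_add_mul_I_le ha.le y
  rw [div_div, div_mul_eq_mul_div, div_le_iff₀ (by positivity)]
  calc _ ≤ Real.Gamma (a + 1) * ‖Complex.Gamma (1 / 2 + y * Complex.I)‖ := by gcongr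
    _ ≤ ‖(a + y * Complex.I : ℂ)‖ * ‖Complex.Gamma (a + y * Complex.I)‖ * Real.Gamma (1 / 2) := by
        rw [mul_comm]; exact h1
    _ ≤ ((a + 1) * (1 + |y|)) * ‖Complex.Gamma (a + y * Complex.I)‖ * Real.Gamma (1 / 2) := by
        gcongr
    _ = _ := by ring

theorem integrable_pow_mul_exp_neg_abs {δ : ℝ} (hδ : 0 < δ) (n : ℕ) :
    Integrable fun y : ℝ => (1 + |y|) ^ n * Real.exp (-(δ * |y|)) := by
  -- Two extra powers leave a factor comparable to the integrable 1 / (1 + y²), after bounding u^m /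
  -- m! by e^u.
  set m := n + 2
  refine (integrable_inv_one_add_sq.const_mul (m.factorial * Real.exp δ / δ ^ m)).mono'
    (by fun_prop) (ae_of_all _ fun y => ?_)
  rw [Real.norm_of_nonneg (by positivity), ← div_eq_mul_inv, le_div_iff₀ (by positivity),
    le_div_iff₀ (by positivity)]
  have h1 := Real.pow_div_factorial_le_exp (x := δ * (1 + |y|)) (by positivity) m
  rw [div_le_iff₀ (by positivity), mul_pow] at h1
  have h2 : 1 + y ^ 2 ≤ (1 + |y|) ^ 2 := by nlinarith [abs_nonneg y, sq_abs y]
  calc _ ≤ (1 + |y|) ^ n * Real.exp (-(δ * |y|)) * (1 + |y|) ^ 2 * δ ^ m := by gcongr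
    _ = (δ ^ m * (1 + |y|) ^ m) * Real.exp (-(δ * |y|)) := by simp only [m]; ring
    _ ≤ (Real.exp (δ * (1 + |y|)) * m.factorial) * Real.exp (-(δ * |y|)) := by gcongr
    _ = m.factorial * (Real.exp (δ * (1 + |y|)) * Real.exp (-(δ * |y|))) := by ring
    _ = _ := by rw [← Real.exp_add]; ring_nf

theorem continuous_Gamma_line {p q : ℝ} (hp : 0 < p) :
    Continuous fun y : ℝ => Complex.Gamma (p + (q * y : ℝ) * Complex.I) := by
  rw [continuous_iff_continuousAt]
  intro y
  refine ContinuousAt.comp (f := fun y : ℝ => (p + (q * y : ℝ) * Complex.I : ℂ))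
    (Complex.differentiableAt_Gamma _ fun m h => ?_).continuousAt (by fun_prop)
  have := congrArg Complex.re h
  simp at this
  have hm : (0 : ℝ) ≤ m := m.cast_nonneg
  linarith

/-- The numerator decays at rate π/(2α) and the reciprocal denominator grows at rate at most π/2;
the net rate (π/2)(1/α - 1) is positive because α < 1. -/
theorem verticalIntegrable_levyKernel {α c : ℝ} (hα0 : 0 < α) (hα1 : α < 1) (hc : c < 1) :
    Complex.VerticalIntegrable (levyKernel α) c := by
  have hp : 0 < (1 - c) / α := div_pos (sub_pos.2 hc) hα0
  have hq : 0 < 1 - c := sub_pos.2 hc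
  obtain ⟨C, hC, n, hup⟩ := exists_norm_Gamma_le hp
  obtain ⟨D, hD, hlow⟩ := exists_le_norm_Gamma hq
  have e1 : ∀ y : ℝ, (1 / α - (c + y * Complex.I) / α : ℂ) =
      (((1 - c) / α : ℝ) : ℂ) + ((-(1 / α) * y : ℝ) : ℂ) * Complex.I := by
    intro y; push_cast; ring
  have e2 : ∀ y : ℝ, (1 - (c + y * Complex.I) : ℂ) =
      ((1 - c : ℝ) : ℂ) + ((-1 * y : ℝ) : ℂ) * Complex.I := by
    intro y; push_cast; ring
  have hne : ∀ y : ℝ, Complex.Gamma (((1 - c : ℝ) : ℂ) + ((-1 * y : ℝ) : ℂ) * Complex.I) ≠ 0 :=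
    fun y => Complex.Gamma_ne_zero_of_re_pos (by simpa using hc)
  have hcont : Continuous fun y : ℝ => levyKernel α (c + y * Complex.I) := by
    simp only [levyKernel, e1, e2]
    refine (continuous_Gamma_line hp).div (continuous_const.mul (continuous_Gamma_line hq))
      fun y => mul_ne_zero (by exact_mod_cast hα0.ne') (hne y)
  have hδ : 0 < Real.pi / 2 * (1 / α - 1) := by
    have : 1 < 1 / α := by rw [lt_div_iff₀ hα0]; linarith
    have := Real.pi_pos
    have : 0 < 1 / α - 1 := by linarith
    positivity
  refine ((integrable_pow_mul_exp_neg_abs hδ (n + 1)).const_mul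
    (C * (1 / α) ^ n / (α * D))).mono' hcont.aestronglyMeasurable (ae_of_all _ fun y => ?_)
  have h1 := hup (-(1 / α) * y)
  have h2 := hlow (-1 * y)
  have hy1 : |-(1 / α) * y| = 1 / α * |y| := by
    rw [abs_mul, abs_neg, abs_of_pos (by positivity)]
  have hy2 : |-1 * y| = |y| := by simp
  rw [hy1] at h1
  rw [hy2] at h2
  have hΓ := norm_pos_iff.2 (hne y)
  simp only [levyKernel, e1, e2]
  rw [norm_div, norm_mul, Complex.norm_real, Real.norm_of_nonneg hα0.le, div_le_iff₀ (by positivity)]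
  have h3 : 1 + 1 / α * |y| ≤ 1 / α * (1 + |y|) := by
    have : 1 ≤ 1 / α := by rw [le_div_iff₀ hα0]; linarith
    nlinarith
  have h4 : Real.exp (-(Real.pi / 2 * (1 / α * |y|))) =
      Real.exp (-(Real.pi / 2 * (1 / α - 1) * |y|)) * Real.exp (-(Real.pi / 2 * |y|)) := by
    rw [← Real.exp_add]; ring_nf
  calc _ ≤ C * (1 + 1 / α * |y|) ^ n * Real.exp (-(Real.pi / 2 * (1 / α * |y|))) := h1
    _ ≤ C * (1 / α * (1 + |y|)) ^ n * Real.exp (-(Real.pi / 2 * (1 / α * |y|))) := by gcongr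
    _ = C * (1 / α) ^ n * (1 + |y|) ^ n * Real.exp (-(Real.pi / 2 * (1 / α - 1) * |y|)) / D *
          (D * Real.exp (-(Real.pi / 2 * |y|))) := by
        rw [h4, mul_pow]; field_simp
    _ ≤ C * (1 / α) ^ n * (1 + |y|) ^ n * Real.exp (-(Real.pi / 2 * (1 / α - 1) * |y|)) / D *
          ((1 + |y|) * ‖Complex.Gamma (((1 - c : ℝ) : ℂ) + ((-1 * y : ℝ) : ℂ) * Complex.I)‖) := by
        gcongr
    _ = _ := by field_simp; ring

/-! ### Mellin-Barnes representations of both densities -/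

/-- The ratio `Γ(γ - w) γ^w / Γ(γ)`. -/
noncomputable def gammaRatio (γ : ℝ) (w : ℂ) : ℂ :=
  γ ^ w * Complex.Gamma (γ - w) / Complex.Gamma γ

section
variable {α γ c : ℝ}

/-- All dependence on γ is isolated in the ratio, so bounds and limits of the kernel reduce to those
of `gammaRatio`. -/
theorem mlKernel_eq (α γ : ℝ) (s : ℂ) :
    mlKernel α γ s = gammaRatio γ ((1 - s) / α) * levyKernel α s := by
  rw [mlKernel, gammaRatio, levyKernel, show (γ : ℂ) + s / α - 1 / α = γ - (1 - s) / α by ring,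
    show (1 / α - s / α : ℂ) = (1 - s) / α by ring]
  ring

theorem norm_gammaRatio_le {w : ℂ} (hw : 0 < w.re) (hwγ : w.re < γ) :
    ‖gammaRatio γ w‖ ≤ ‖gammaRatio γ w.re‖ := by
  have hγ : 0 < γ := hw.trans hwγ
  have h := norm_Gamma_le (s := γ - w) (by simpa using hwγ)
  rw [gammaRatio, gammaRatio, norm_div, norm_div, norm_mul, norm_mul,
    Complex.norm_cpow_eq_rpow_re_of_pos hγ, Complex.norm_cpow_eq_rpow_re_of_pos hγ,
    Complex.ofReal_re, ← Complex.ofReal_sub, Complex.Gamma_ofReal (γ - w.re), Complex.norm_real,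
    Real.norm_of_nonneg (Real.Gamma_pos_of_pos (sub_pos.2 hwγ)).le]
  rw [Complex.sub_re, Complex.ofReal_re] at h
  gcongr

/-- Bernoulli's inequality with exponent γ/γ₀ ≥ 1 shows that (1 + t/γ)^γ increases with γ. -/
theorem one_add_div_rpow_le {γ₀ t : ℝ} (hγ₀ : 0 < γ₀) (h : γ₀ ≤ γ) (ht : 0 ≤ t) :
    (1 + t / γ) ^ (-γ) ≤ (1 + t / γ₀) ^ (-γ₀) := by
  have hγ : 0 < γ := hγ₀.trans_le h
  have h1 := one_add_mul_self_le_rpow_one_add (s := t / γ) (by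
    have : 0 ≤ t / γ := by positivity
    linarith) (p := γ / γ₀) (by rwa [one_le_div hγ₀])
  have h2 : γ / γ₀ * (t / γ) = t / γ₀ := by field_simp
  rw [h2] at h1
  have h3 : (1 + t / γ) ^ (-γ) = ((1 + t / γ) ^ (γ / γ₀)) ^ (-γ₀) := by
    rw [← Real.rpow_mul (by positivity)]; congr 1; field_simp
  rw [h3]
  exact Real.rpow_le_rpow_of_nonpos (by positivity) h1 (by linarith)

theorem tendsto_one_add_div_rpow_neg (t : ℝ) :
    Tendsto (fun γ : ℝ => (1 + t / γ) ^ (-γ)) atTop (𝓝 (Real.exp (-t))) := by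
  have h := (Real.tendsto_one_add_div_rpow_exp t).inv₀ (Real.exp_ne_zero _)
  rw [← Real.exp_neg] at h
  refine h.congr' ?_
  have h2 : Tendsto (fun γ : ℝ => 1 + t / γ) atTop (𝓝 (1 + 0)) :=
    tendsto_const_nhds.add (tendsto_const_nhds.div_atTop tendsto_id)
  filter_upwards [h2.eventually_const_lt (u := 0) (by norm_num)] with γ hγ
  rw [Real.rpow_neg hγ.le]

/-- Γ(w) times the ratio is the Mellin transform of (1 + t/γ)^(-γ), which tends to that of e^(-t),
namely Γ(w). Monotonicity in γ supplies the dominating function. -/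
theorem tendsto_gammaRatio {w : ℂ} (hw : 0 < w.re) :
    Tendsto (fun γ : ℝ => gammaRatio γ w) atTop (𝓝 1) := by
  have hΓ := Complex.Gamma_ne_zero_of_re_pos hw
  have hlim : Tendsto (fun γ : ℝ => mellin (fun t : ℝ => (((1 + t / γ) ^ (-γ) : ℝ) : ℂ)) w) atTop
      (𝓝 (mellin (fun t : ℝ => ((Real.exp (-t) : ℝ) : ℂ)) w)) := by
    set γ₀ := w.re + 1 with hγ₀
    have hγ₀0 : 0 < γ₀ := by positivity
    have hb := (mellin_one_add_div_rpow hw (show w.re < γ₀ by linarith)).1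
    refine tendsto_integral_filter_of_dominated_convergence _ ?_ ?_ hb.norm ?_
    · filter_upwards [eventually_ge_atTop γ₀] with γ hγ
      exact (mellin_one_add_div_rpow hw (show w.re < γ by linarith)).1.aestronglyMeasurable
    · filter_upwards [eventually_ge_atTop γ₀] with γ hγ
      filter_upwards [ae_restrict_mem measurableSet_Ioi] with t ht
      have ht' : 0 ≤ t := le_of_lt ht
      have hγ' : 0 < γ := hγ₀0.trans_le hγ
      rw [norm_smul, norm_smul, Complex.norm_real, Complex.norm_real,
        Real.norm_of_nonneg (by positivity), Real.norm_of_nonneg (by positivity)]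
      exact mul_le_mul_of_nonneg_left (one_add_div_rpow_le hγ₀0 hγ ht') (norm_nonneg _)
    · refine ae_of_all _ fun t => ?_
      exact ((Complex.continuous_ofReal.tendsto _).comp (tendsto_one_add_div_rpow_neg t)).const_smul _
  rw [(hasMellin_exp_neg hw).2] at hlim
  have h := hlim.div_const (Complex.Gamma w)
  rw [div_self hΓ] at h
  refine h.congr' ?_
  filter_upwards [eventually_gt_atTop w.re] with γ hγ
  rw [(mellin_one_add_div_rpow hw hγ).2, gammaRatio]
  field_simp

theorem continuous_gammaRatio_line (hα : 0 < α) (hγ : 0 < γ) (hc : 1 - α * γ < c) :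
    Continuous fun y : ℝ => gammaRatio γ ((1 - (c + y * Complex.I)) / α) := by
  have hp : 0 < γ - (1 - c) / α := by
    rw [sub_pos, div_lt_iff₀ hα]; linarith
  have e : ∀ y : ℝ, (γ : ℂ) - (1 - (c + y * Complex.I)) / α =
      ((γ - (1 - c) / α : ℝ) : ℂ) + ((1 / α * y : ℝ) : ℂ) * Complex.I := by
    intro y; push_cast; ring
  simp only [gammaRatio, e]
  refine (Continuous.mul ?_ (continuous_Gamma_line hp)).div_const _
  exact Continuous.const_cpow (by fun_prop) (Or.inl (by exact_mod_cast hγ.ne'))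

theorem re_one_sub_div {s : ℂ} (hs : s.re = c) : ((1 - s) / (α : ℂ)).re = (1 - c) / α := by
  rw [Complex.div_ofReal_re, Complex.sub_re, Complex.one_re, hs]

theorem norm_mlKernel_le (hα : 0 < α) (hc : 1 - α * γ < c) (hc1 : c < 1) {s : ℂ} (hs : s.re = c) :
    ‖mlKernel α γ s‖ ≤ ‖gammaRatio γ ((1 - c) / α : ℝ)‖ * ‖levyKernel α s‖ := by
  have hre := re_one_sub_div (α := α) hs
  rw [mlKernel_eq, norm_mul]
  gcongr
  rw [← hre]
  exact norm_gammaRatio_le (by rw [hre]; exact div_pos (sub_pos.2 hc1) hα)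
    (by rw [hre, div_lt_iff₀ hα]; linarith)

theorem verticalIntegrable_mlKernel (hα0 : 0 < α) (hα1 : α < 1) (hγ : 0 < γ)
    (hc : 1 - α * γ < c) (hc1 : c < 1) : Complex.VerticalIntegrable (mlKernel α γ) c := by
  have hL := verticalIntegrable_levyKernel hα0 hα1 hc1
  refine Integrable.mono' (hL.norm.const_mul ‖gammaRatio γ ((1 - c) / α : ℝ)‖) ?_
    (ae_of_all _ fun y => norm_mlKernel_le hα0 hc hc1 (by simp))
  simp_rw [mlKernel_eq]
  exact (continuous_gammaRatio_line hα0 hγ hc).aestronglyMeasurable.mul hL.aestronglyMeasurable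

theorem hasMellinBarnes_mlDensity (hα0 : 0 < α) (hα1 : α < 1) (hγ : 0 < γ)
    (hc : 1 - α * γ < c) (hc1 : c < 1) : HasMellinBarnes (mlDensity α γ) (mlKernel α γ) c := by
  obtain ⟨hd, hL⟩ := isPositiveDensity_mlDensity_and_laplace hα0 hα1 hγ
  refine hasMellinBarnes_of_laplace hd (continuousOn_mlDensity hα0 hγ)
    (Φ := fun t => (1 + t ^ α / γ) ^ (-γ))
    (fun t ht => (hL t (by simpa using ht.le)).trans (mlLaplace_ofReal hγ ht.le)) hc1
    (fun s hs => ?_) (verticalIntegrable_mlKernel hα0 hα1 hγ hc hc1)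
  have hre := re_one_sub_div (α := α) hs
  have h := (mellin_one_add_div_rpow (γ := γ) (w := (1 - s) / α)
    (by rw [hre]; exact div_pos (sub_pos.2 hc1) hα0)
    (by rw [hre, div_lt_iff₀ hα0]; linarith)).comp_rpow hα0
  convert h using 1
  have hΓ : Complex.Gamma (1 - s) ≠ 0 := Complex.Gamma_ne_zero_of_re_pos (by simpa [hs] using hc1)
  rw [mlKernel_eq, gammaRatio, levyKernel, show (1 / α - s / α : ℂ) = (1 - s) / α by ring]
  field_simp

/-- Stated for an arbitrary Lévy density, so that it yields uniqueness as well as the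
representation. -/
theorem IsLevyDensity.hasMellinBarnes {h : ℝ → ℝ} (hh : IsLevyDensity α h) (hα0 : 0 < α)
    (hα1 : α < 1) (hc1 : c < 1) : HasMellinBarnes h (levyKernel α) c := by
  refine hasMellinBarnes_of_laplace hh.density hh.continuousOn (Φ := fun t => Real.exp (-t ^ α))
    (fun t ht => ?_) hc1 (fun s hs => ?_) (verticalIntegrable_levyKernel hα0 hα1 hc1)
  · rw [hh.laplace t (by simpa using ht.le), ← Complex.ofReal_cpow ht.le]
    push_cast
    rfl
  · have hre := re_one_sub_div (α := α) hs
    have h := (hasMellin_exp_neg (w := (1 - s) / α)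
      (by rw [hre]; exact div_pos (sub_pos.2 hc1) hα0)).comp_rpow hα0
    convert h using 1
    have hΓ : Complex.Gamma (1 - s) ≠ 0 := Complex.Gamma_ne_zero_of_re_pos (by simpa [hs] using hc1)
    rw [levyKernel, show (1 / α - s / α : ℂ) = (1 - s) / α by ring]
    field_simp

/-! ### The Lévy density as a limit -/

/-- The one-sided stable density, defined by its Mellin-Barnes integral. -/
noncomputable def levyDensity (α x : ℝ) : ℝ :=
  if 0 < x then (mellinInv (1 / 2) (levyKernel α) x).re else 0

theorem norm_mellinInv_integrand (σ y : ℝ) (F : ℂ → ℂ) {x : ℝ} (hx : 0 < x) :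
    ‖(x : ℂ) ^ (-(σ + y * Complex.I)) • F (σ + y * Complex.I)‖ =
      x ^ (-σ) * ‖F (σ + y * Complex.I)‖ := by
  rw [norm_smul, Complex.norm_cpow_eq_rpow_re_of_pos hx]
  simp

/-- The constant 2 is any number above 1, the limit of the ratio at the real point (1 - c)/α that
controls the whole line. -/
theorem eventually_norm_mlKernel_le (hα0 : 0 < α) (hc1 : c < 1) :
    ∀ᶠ γ in atTop, 0 < γ ∧ 1 - α * γ < c ∧
      ∀ s : ℂ, s.re = c → ‖mlKernel α γ s‖ ≤ 2 * ‖levyKernel α s‖ := by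
  have hw : 0 < (((1 - c) / α : ℝ) : ℂ).re := by simpa using div_pos (sub_pos.2 hc1) hα0
  have h1 := (tendsto_gammaRatio hw).norm.eventually_le_const (u := 2) (by norm_num)
  have h2 : ∀ᶠ γ : ℝ in atTop, (1 - c) / α < γ := eventually_gt_atTop _
  filter_upwards [h1, h2, eventually_gt_atTop 0] with γ h1 h2 h3
  rw [div_lt_iff₀ hα0] at h2
  refine ⟨h3, by linarith, fun s hs => ?_⟩
  exact (norm_mlKernel_le hα0 (by linarith) hc1 hs).trans (by gcongr)

theorem tendsto_mellinInv_mlKernel (hα0 : 0 < α) (hα1 : α < 1) (hc1 : c < 1) {x : ℝ} (hx : 0 < x) :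
    Tendsto (fun γ => mellinInv c (mlKernel α γ) x) atTop (𝓝 (mellinInv c (levyKernel α) x)) := by
  have hL := verticalIntegrable_levyKernel hα0 hα1 hc1
  have hmeas : Measurable fun y : ℝ => (x : ℂ) ^ (-(c + y * Complex.I)) := by fun_prop
  refine Tendsto.const_smul (tendsto_integral_filter_of_dominated_convergence
    (fun y : ℝ => x ^ (-c) * (2 * ‖levyKernel α (c + y * Complex.I)‖)) ?_ ?_
    ((hL.norm.const_mul 2).const_mul _) ?_) _
  · filter_upwards [eventually_norm_mlKernel_le hα0 hc1] with γ hγ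
    exact hmeas.aestronglyMeasurable.smul
      (verticalIntegrable_mlKernel hα0 hα1 hγ.1 hγ.2.1 hc1).aestronglyMeasurable
  · filter_upwards [eventually_norm_mlKernel_le hα0 hc1] with γ hγ
    refine ae_of_all _ fun y => ?_
    rw [norm_mellinInv_integrand c y _ hx]
    have := hγ.2.2 (c + y * Complex.I) (by simp)
    gcongr
  · refine ae_of_all _ fun y => Tendsto.const_smul ?_ _
    simp_rw [mlKernel_eq]
    have h := tendsto_gammaRatio (w := (1 - (c + y * Complex.I)) / α)
      (by rw [re_one_sub_div (c := c) (by simp)]; exact div_pos (sub_pos.2 hc1) hα0)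
    simpa using h.mul_const (levyKernel α (c + y * Complex.I))

theorem tendsto_mlDensity (hα0 : 0 < α) (hα1 : α < 1) (x : ℝ) :
    Tendsto (fun γ => mlDensity α γ x) atTop (𝓝 (levyDensity α x)) := by
  rcases lt_or_ge 0 x with hx | hx
  · have h := (Complex.continuous_re.tendsto _).comp
      (tendsto_mellinInv_mlKernel (c := 1 / 2) hα0 hα1 (by norm_num) hx)
    rw [levyDensity, if_pos hx]
    refine h.congr' ?_
    filter_upwards [eventually_norm_mlKernel_le (c := 1 / 2) hα0 (by norm_num)] with γ hγ
    rw [Function.comp_apply, ← (hasMellinBarnes_mlDensity hα0 hα1 hγ.1 hγ.2.1 (by norm_num)).2 x hx,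
      Complex.ofReal_re]
  · simp only [mlDensity_of_nonpos hx, levyDensity, if_neg hx.not_gt]
    exact tendsto_const_nhds

/-- The inversion integral on Re s = 1/2 is estimated in absolute value. The bound is uniform in
large γ and integrable at 0, as dominated convergence of the Laplace transforms requires. -/
theorem exists_eventually_mlDensity_le (hα0 : 0 < α) (hα1 : α < 1) :
    ∃ C : ℝ, ∀ᶠ γ in atTop, 0 < γ ∧ ∀ x > 0, mlDensity α γ x ≤ C * x ^ (-(1 / 2) : ℝ) := by
  set A : ℝ := ∫ y : ℝ, ‖levyKernel α (((1 / 2 : ℝ) : ℂ) + y * Complex.I)‖ with hA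
  refine ⟨1 / (2 * Real.pi) * (2 * A), ?_⟩
  filter_upwards [eventually_norm_mlKernel_le (c := 1 / 2) hα0 (by norm_num)] with γ hγ
  refine ⟨hγ.1, fun x hx => ?_⟩
  have h := (hasMellinBarnes_mlDensity hα0 hα1 hγ.1 hγ.2.1 (by norm_num)).2 x hx
  have hL := verticalIntegrable_levyKernel (c := 1 / 2) hα0 hα1 (by norm_num)
  calc mlDensity α γ x ≤ ‖(mlDensity α γ x : ℂ)‖ := by
        rw [Complex.norm_real]; exact le_abs_self _
    _ ≤ 1 / (2 * Real.pi) * ∫ y : ℝ, x ^ (-(1 / 2) : ℝ) *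
          (2 * ‖levyKernel α (((1 / 2 : ℝ) : ℂ) + y * Complex.I)‖) := by
        rw [h, mellinInv, norm_smul, Real.norm_of_nonneg (by positivity)]
        gcongr
        refine norm_integral_le_of_norm_le ((hL.norm.const_mul 2).const_mul _)
          (ae_of_all _ fun y => ?_)
        rw [norm_mellinInv_integrand (1 / 2) y _ hx]
        have := hγ.2.2 (((1 / 2 : ℝ) : ℂ) + y * Complex.I) (by simp)
        gcongr
    _ = _ := by rw [integral_const_mul, integral_const_mul]; ring

theorem continuousOn_levyDensity (hα0 : 0 < α) (hα1 : α < 1) :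
    ContinuousOn (levyDensity α) (Ioi 0) := by
  have hL := verticalIntegrable_levyKernel (c := 1 / 2) hα0 hα1 (by norm_num)
  have hc : ContinuousOn (fun x : ℝ => mellinInv (1 / 2) (levyKernel α) x) (Ioi 0) := by
    intro x hx
    have hx' : 0 < x := hx
    refine ContinuousAt.continuousWithinAt (ContinuousAt.const_smul ?_ _)
    refine continuousAt_of_dominated (bound := fun y => (x / 2) ^ (-(1 / 2) : ℝ) *
      ‖levyKernel α (((1 / 2 : ℝ) : ℂ) + y * Complex.I)‖) ?_ ?_ (hL.norm.const_mul _) ?_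
    · refine Eventually.of_forall fun z => ?_
      have hmeas : Measurable fun y : ℝ => (z : ℂ) ^ (-(((1 / 2 : ℝ) : ℂ) + y * Complex.I)) := by
        fun_prop
      exact hmeas.aestronglyMeasurable.smul hL.aestronglyMeasurable
    · filter_upwards [lt_mem_nhds (show x / 2 < x by linarith)] with z hz
      have hz0 : 0 < z := by linarith
      refine ae_of_all _ fun y => ?_
      rw [norm_mellinInv_integrand _ y _ hz0]
      refine mul_le_mul_of_nonneg_right ?_ (norm_nonneg _)
      exact Real.rpow_le_rpow_of_nonpos (by linarith) hz.le (by norm_num)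
    · refine ae_of_all _ fun y => Tendsto.smul_const ?_ _
      exact ContinuousAt.cpow Complex.continuous_ofReal.continuousAt continuousAt_const
        (Or.inl (by simpa using hx'))
  exact (Complex.continuous_re.comp_continuousOn hc).congr fun x hx => if_pos hx

theorem tendsto_mlLaplace (α : ℝ) (s : ℂ) :
    Tendsto (fun γ : ℝ => mlLaplace α γ s) atTop (𝓝 (Complex.exp (-s ^ (α : ℂ)))) := by
  have h := ((Complex.tendsto_one_add_div_cpow_exp (s ^ (α : ℂ))).comp tendsto_id).inv₀
    (Complex.exp_ne_zero _)
  rw [← Complex.exp_neg] at h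
  simpa [mlLaplace, Complex.cpow_neg] using h

/-- Nonnegativity and the x^(-1/2) bound pass to the pointwise limit. That no mass escapes follows
from exp(-s^α) being continuous on the closed half-plane with value 1 at 0. -/
theorem isLevyDensity_levyDensity (hα0 : 0 < α) (hα1 : α < 1) : IsLevyDensity α (levyDensity α) := by
  obtain ⟨C, hC⟩ := exists_eventually_mlDensity_le hα0 hα1
  have hlim := tendsto_mlDensity hα0 hα1
  have hcont := continuousOn_levyDensity hα0 hα1
  have h0 : ∀ x ≤ 0, levyDensity α x = 0 := fun x hx => if_neg hx.not_gt
  have hn : ∀ x, 0 ≤ levyDensity α x := fun x => ge_of_tendsto (hlim x)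
    ((eventually_gt_atTop 0).mono fun γ hγ => mlDensity_nonneg hα0 hα1 hγ x)
  have hle : ∀ x > 0, levyDensity α x ≤ C * x ^ (-(1 / 2) : ℝ) := fun x hx =>
    le_of_tendsto (hlim x) (hC.mono fun γ hγ => hγ.2 x hx)
  have hbound : ∀ ε > 0, IntegrableOn
      (fun x : ℝ => Real.exp (-ε * x) * (C * x ^ (-(1 / 2) : ℝ))) (Ioi 0) := by
    intro ε hε
    have h := (integrableOn_rpow_mul_exp_neg_mul (a := 1 / 2) (by norm_num) hε).const_mul C
    refine IntegrableOn.congr_fun h (fun x _ => ?_) measurableSet_Ioi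
    rw [show (1 / 2 - 1 : ℝ) = -(1 / 2) by norm_num, neg_mul]
    ring
  have hI : ∀ ε > 0, IntegrableOn (fun x => Real.exp (-ε * x) * levyDensity α x) (Ioi 0) := by
    intro ε hε
    refine (hbound ε hε).mono' ((by fun_prop : Continuous fun x : ℝ =>
      Real.exp (-ε * x)).aestronglyMeasurable.mul
        (hcont.aestronglyMeasurable measurableSet_Ioi)) ?_
    filter_upwards [ae_restrict_mem measurableSet_Ioi] with x hx
    rw [Real.norm_of_nonneg (mul_nonneg (Real.exp_nonneg _) (hn x))]
    exact mul_le_mul_of_nonneg_left (hle x hx) (Real.exp_nonneg _)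
  have hL : ∀ s : ℂ, 0 < s.re →
      laplaceTransform (levyDensity α) s = Complex.exp (-s ^ (α : ℂ)) := by
    intro s hs
    have h1 : Tendsto (fun γ => laplaceTransform (mlDensity α γ) s) atTop
        (𝓝 (laplaceTransform (levyDensity α) s)) := by
      refine tendsto_integral_filter_of_dominated_convergence _ ?_ ?_ (hbound s.re hs) ?_
      · filter_upwards [eventually_gt_atTop 0] with γ hγ
        exact (by fun_prop : Continuous fun x : ℝ =>
          Complex.exp (-s * x)).aestronglyMeasurable.mul
            (Complex.continuous_ofReal.comp_aestronglyMeasurable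
              ((continuousOn_mlDensity hα0 hγ).aestronglyMeasurable measurableSet_Ioi))
      · filter_upwards [hC] with γ hγ
        filter_upwards [ae_restrict_mem measurableSet_Ioi] with x hx
        rw [norm_mul, norm_exp_neg_mul_ofReal, Complex.norm_real,
          Real.norm_of_nonneg (mlDensity_nonneg hα0 hα1 hγ.1 x)]
        exact mul_le_mul_of_nonneg_left (hγ.2 x hx) (Real.exp_nonneg _)
      · exact ae_of_all _ fun x =>
          ((Complex.continuous_ofReal.tendsto _).comp (hlim x)).const_mul _
    refine tendsto_nhds_unique h1 ((tendsto_mlLaplace α s).congr' ?_)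
    filter_upwards [eventually_gt_atTop 0] with γ hγ
    exact (laplaceTransform_mlDensity_of_re_pos hα0 hα1 hγ hs).symm
  obtain ⟨h1, h2⟩ := isPositiveDensity_and_laplace (Φ := fun s => Complex.exp (-s ^ (α : ℂ)))
    h0 hn hI (fun s hs => (Complex.continuousAt_cpow_const_of_re_pos (Or.inl hs)
      (by simpa using hα0)).neg.cexp)
    (by simp [Complex.zero_cpow (show (α : ℂ) ≠ 0 by exact_mod_cast hα0.ne')]) hL
  exact ⟨h1, hcont, h2⟩

theorem IsLevyDensity.unique {h ℓ : ℝ → ℝ} (hh : IsLevyDensity α h) (hℓ : IsLevyDensity α ℓ)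
    (hα0 : 0 < α) (hα1 : α < 1) : h = ℓ := by
  funext x
  rcases lt_or_ge 0 x with hx | hx
  · have h1 := (hh.hasMellinBarnes (c := 1 / 2) hα0 hα1 (by norm_num)).2 x hx
    have h2 := (hℓ.hasMellinBarnes (c := 1 / 2) hα0 hα1 (by norm_num)).2 x hx
    exact_mod_cast h1.trans h2.symm
  · rw [hh.density.eq_zero x hx, hℓ.density.eq_zero x hx]

end

/-! ### The main theorem -/

theorem mainTheorem1 (α : ℝ) (hα0 : 0 < α) (hα1 : α < 1) :
    (∀ γ : ℝ, 0 < γ →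
      (∀ z : ℝ, Summable fun k : ℕ =>
        (ascPochhammer ℝ k).eval γ * z ^ k / (k.factorial * Real.Gamma (α * k + α * γ))) ∧
      IsPositiveDensity (mlDensity α γ) ∧
      (∀ s : ℂ, 0 ≤ s.re →
        laplaceTransform (mlDensity α γ) s = (1 + s ^ (α : ℂ) / γ) ^ (-γ : ℂ)) ∧
      (∀ c : ℝ, max 0 (1 - α * γ) < c → c < 1 →
        HasMellinBarnes (mlDensity α γ) (mlKernel α γ) c)) ∧
    ∃ ℓ : ℝ → ℝ,
      IsLevyDensity α ℓ ∧
      (∀ h : ℝ → ℝ, IsLevyDensity α h → h = ℓ) ∧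
      (∀ x : ℝ, Tendsto (fun γ : ℝ => mlDensity α γ x) atTop (𝓝 (ℓ x))) ∧
      (∀ s : ℂ, 0 ≤ s.re →
        Tendsto (fun γ : ℝ => laplaceTransform (mlDensity α γ) s) atTop
          (𝓝 (laplaceTransform ℓ s))) ∧
      (∀ c : ℝ, 0 < c → c < 1 → HasMellinBarnes ℓ (levyKernel α) c) := by
  have hℓ := isLevyDensity_levyDensity hα0 hα1
  refine ⟨fun γ hγ => ?_, levyDensity α, hℓ, fun h hh => hh.unique hℓ hα0 hα1,
    tendsto_mlDensity hα0 hα1, fun s hs => ?_, fun c _ hc1 => hℓ.hasMellinBarnes hα0 hα1 hc1⟩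
  · obtain ⟨hd, hL⟩ := isPositiveDensity_mlDensity_and_laplace hα0 hα1 hγ
    refine ⟨fun z => ?_, hd, hL, fun c hc hc1 =>
      hasMellinBarnes_mlDensity hα0 hα1 hγ ((le_max_right _ _).trans_lt hc) hc1⟩
    refine (summable_pochCoeff_div_Gamma (γ := γ) hα0 (mul_pos hα0 hγ) z).congr fun k => ?_
    rw [pochCoeff]
    field_simp
  · rw [hℓ.laplace s hs]
    refine (tendsto_mlLaplace α s).congr' ?_
    filter_upwards [eventually_gt_atTop 0] with γ hγ
    exact ((isPositiveDensity_mlDensity_and_laplace hα0 hα1 hγ).2 s hs).symm
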